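/- Let $N \ge 1$, $\sigma \in (0,1)$, let $\Omega \subseteq \mathbb{R}^N$ be a bounded open set with boundary of class $C^2$, and let $\overline{\alpha} < 1$. Write $\delta = \mathrm{dist}(\cdot, \mathbb{R}^N \setminus \Omega)$, $t_+ = \max\{t, 0\}$, and let $(-\Delta)^\sigma$ be the fractional Laplacian $$(-\Delta)^\sigma u(x) = c_{N,\sigma} \lim_{\varepsilon \downarrow 0} \int_{\mathbb{R}^N \setminus B_\varepsilon(x)} \frac{u(x) - u(y)}{|x-y|^{N + 2\sigma}} \, dy, \qquad c_{N,\sigma} = \frac{4^\sigma \, \Gamma(N/2 + \sigma)}{\pi^{N/2} \, |\Gamma(-\sigma)|},$$ where the normalization $c_{N,\sigma}$ is the one for which the operator has Fourier symbol $|\xi|^{2\sigma}$. Then there is a constant $C > 0$, depending only on $N$, $\Omega$, $\sigma$ and $\overline{\alpha}$, with the following property. Let $0 < \alpha \le \overline{\alpha}$. Let $\Phi : \Omega \times \mathbb{R} \to \mathbb{R}$ be a Carathéodory function such that, for a.e. $x \in \Omega$, $\Phi(x, \cdot)$ is non-decreasing and $\Phi(x, 0) \ge 0$. Let $f$ be such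 that $\delta^{2 - \alpha} f \in L^\infty(\Omega)$, let $g \in L^\infty(\partial\Omega)$ (with respect to surface measure) and $h \in L^\infty(\mathbb{R}^N \setminus \overline{\Omega})$. Let $\underline{w} \in L^\infty(\mathbb{R}^N) \cap C^2(\Omega) \cap C^0(\overline{\Omega})$ satisfy $$-\Delta \underline{w} + \Phi\big(\cdot, (-\Delta)^\sigma \underline{w}\big) \le f \ \text{ in } \Omega, \qquad \underline{w} \le g \ \text{ on } \partial\Omega, \qquad \underline{w} \le h \ \text{ in } \mathbb{R}^N \setminus \overline{\Omega},$$ each almost everywhere. Then $$\sup_{\Omega} \underline{w} \le \sup_{\partial\Omega} g_+ + \sup_{\mathbb{R}^N \setminus \overline{\Omega}} h_+ + C \alpha^{-1} \sup_{\Omega} \big( \delta^{2-\alpha} f_+ \big),$$ where the suprema on the right-hand side are essential suprema. -/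

import Mathlib

open MeasureTheory Set Filter Topology
open scoped ENNReal RealInnerProductSpace InnerProductSpace

/-- The constant `c_{N,σ} = 4^σ Γ(N/2 + σ) / (π^{N/2} |Γ(-σ)|)`, where `|Γ(-σ)| = Γ(1 - σ) / σ` for
`0 < σ < 1`; it is the normalization for which the fractional Laplacian below has the Fourier
symbol `|ξ|^{2σ}`. -/
noncomputable def fracConst (N : ℕ) (σ : ℝ) : ℝ :=
  4 ^ σ * Real.Gamma (N / 2 + σ) * σ / (Real.pi ^ ((N : ℝ) / 2) * Real.Gamma (1 - σ))

/-- The fractional Laplacian of order `2σ`, as the pointwise principal value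
`c_{N,σ} lim_{ε ↓ 0} ∫_{|x - y| ≥ ε} (u x - u y) / |x - y|^{N + 2σ} dy`. -/
noncomputable def fracLaplacian {N : ℕ} (σ : ℝ) (u : EuclideanSpace ℝ (Fin N) → ℝ)
    (x : EuclideanSpace ℝ (Fin N)) : ℝ :=
  fracConst N σ *
    limUnder (𝓝[>] (0 : ℝ)) (fun ε : ℝ =>
      ∫ y in (Metric.ball x ε)ᶜ, (u x - u y) / ‖x - y‖ ^ ((N : ℝ) + 2 * σ))

/-- `Ω` has boundary of class `C²`: near each boundary point, and after choosing a unit vector `ν`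
as the vertical direction, `Ω` is the strict epigraph of a `C²` function on the hyperplane
orthogonal to `ν`. -/
def HasC2Boundary {N : ℕ} (Ω : Set (EuclideanSpace ℝ (Fin N))) : Prop :=
  ∀ x₀ ∈ frontier Ω, ∃ (ν : EuclideanSpace ℝ (Fin N)) (r : ℝ) (γ : (ℝ ∙ ν)ᗮ → ℝ),
    ‖ν‖ = 1 ∧ 0 < r ∧ ContDiff ℝ 2 γ ∧
      ∀ x ∈ Metric.ball x₀ r, x ∈ Ω ↔ γ ((ℝ ∙ ν)ᗮ.orthogonalProjectionOnto x) < ⟪ν, x⟫_ℝ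

/-- The function `δ = dist(·, ℝ^N \ Ω)`. -/
noncomputable def distCompl {N : ℕ} (Ω : Set (EuclideanSpace ℝ (Fin N)))
    (x : EuclideanSpace ℝ (Fin N)) : ℝ :=
  Metric.infDist x Ωᶜ

/-- The surface measure of `∂Ω` (up to a positive constant factor, which affects neither
`L^∞(∂Ω)` nor essential suprema): the `(N - 1)`-dimensional Hausdorff measure on the boundary. -/
noncomputable def bdryMeasure {N : ℕ} (Ω : Set (EuclideanSpace ℝ (Fin N))) :
    Measure (EuclideanSpace ℝ (Fin N)) :=
  (Measure.hausdorffMeasure ((N : ℝ) - 1)).restrict (frontier Ω)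

/-- `Φ : Ω × ℝ → ℝ` is a Carathéodory function: Lebesgue measurable in the first variable,
continuous in the second one for a.e. value of the first. Only the values at points of `Ω`
matter. -/
structure IsCaratheodory {N : ℕ} (Ω : Set (EuclideanSpace ℝ (Fin N)))
    (Φ : EuclideanSpace ℝ (Fin N) → ℝ → ℝ) : Prop where
  aemeasurable : ∀ t : ℝ, AEMeasurable (fun x => Φ x t) (volume.restrict Ω)
  continuous : ∀ᵐ x ∂(volume.restrict Ω), Continuous (Φ x)

/-- The inequalities `-Δw + Φ(·, (-Δ)^σ w) ≤ f` in `Ω`, `w ≤ g` on `∂Ω`, `w ≤ h` outside the closure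
of `Ω`, each almost everywhere. -/
structure IsSubsolution {N : ℕ} (σ : ℝ) (Ω : Set (EuclideanSpace ℝ (Fin N)))
    (Φ : EuclideanSpace ℝ (Fin N) → ℝ → ℝ) (f g h w : EuclideanSpace ℝ (Fin N) → ℝ) : Prop where
  interior : ∀ᵐ x ∂(volume.restrict Ω), -(Laplacian.laplacian w x) + Φ x (fracLaplacian σ w x) ≤ f x
  boundary : ∀ᵐ x ∂(bdryMeasure Ω), w x ≤ g x
  exterior : ∀ᵐ x ∂(volume.restrict (closure Ω)ᶜ), w x ≤ h x

/-! The proof compares `w` with the discontinuous barrier that equals `Mg + Mh + B (K + ψ(δ))` on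
`closure Ω` and `Mh` outside, where `ψ` is `profile κ α` and `B` is a multiple of `α⁻¹ (F + ε)`.
Suppose `w` exceeds it somewhere in `closure Ω`, and let `x₀` maximize the difference. The boundary
data force `x₀ ∈ Ω`; put `d = δ(x₀)`.

Let `q` be the centre of the exterior ball of radius `ρ` at a boundary point nearest to `x₀`. Then
`δ(y) ≤ |y - q| - ρ` on `closure Ω`, with equality at `x₀`, so `w` is touched from above by a smooth
radial function even where `δ` is not differentiable. Curvature costs at most `(N/ρ) ψ'`; the
exponential in `ψ` with `κ = N/ρ` absorbs this and leaves `-Δw(x₀) ≥ (F + ε) d^(α-2)`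
(`laplacian_le_of_touching_profile`, `profileDeriv2_add_le`).

The jump `B K` across the boundary makes `(-Δ)^σ w(x₀)` positive (`fracLaplacian_pos`). The possible
negative part is at most a constant times `B d^(-2σ)`, while the drop on a ball of radius comparable
to `d` in the exterior contributes at least a constant times `B K d^(-2σ)`. The powers of `d` agree
and `ψ ≤ 1`, `t ψ'(t) ≤ 1` hold uniformly in `α`, so `K` depends on neither.

By continuity `(-Δ)^σ w > 0` near `x₀`; there monotonicity gives `Φ ≥ Φ(·, 0) ≥ 0`, hence `-Δw ≤ f ≤
F δ^(α-2)` almost everywhere, and at `x₀` by continuity. This contradicts the previous lower bound.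
-/

/-- The concave profile `t ↦ (1 - e^{-κ t})^α` of the barrier, as a function of the distance to the
boundary. -/
noncomputable def profile (κ α t : ℝ) : ℝ := (1 - Real.exp (-(κ * t))) ^ α

/-- The first derivative of `profile`. -/
noncomputable def profileDeriv (κ α t : ℝ) : ℝ :=
  α * (1 - Real.exp (-(κ * t))) ^ (α - 1) * (κ * Real.exp (-(κ * t)))

/-- The second derivative of `profile`. -/
noncomputable def profileDeriv2 (κ α t : ℝ) : ℝ :=
  -(κ * profileDeriv κ α t) -
    α * (1 - α) * (1 - Real.exp (-(κ * t))) ^ (α - 2) * (κ * Real.exp (-(κ * t))) ^ 2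

/-! ### The one-dimensional barrier profile -/

section profile

variable {κ α : ℝ}

lemma one_sub_exp_pos (hκ : 0 < κ) {t : ℝ} (ht : 0 < t) : 0 < 1 - Real.exp (-(κ * t)) := by
  have : Real.exp (-(κ * t)) < 1 := by
    rw [Real.exp_lt_one_iff]
    have := mul_pos hκ ht
    linarith
  linarith

lemma one_sub_exp_nonneg (hκ : 0 < κ) {t : ℝ} (ht : 0 ≤ t) : 0 ≤ 1 - Real.exp (-(κ * t)) := by
  have : Real.exp (-(κ * t)) ≤ 1 := by
    rw [Real.exp_le_one_iff]
    have := mul_nonneg hκ.le ht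
    linarith
  linarith

lemma profile_zero (hα : 0 < α) : profile κ α 0 = 0 := by
  simp [profile, Real.zero_rpow hα.ne']

lemma profile_nonneg (hκ : 0 < κ) {t : ℝ} (ht : 0 ≤ t) : 0 ≤ profile κ α t :=
  Real.rpow_nonneg (one_sub_exp_nonneg hκ ht) _

lemma profile_le_one (hκ : 0 < κ) (hα : 0 < α) {t : ℝ} (ht : 0 ≤ t) : profile κ α t ≤ 1 := by
  refine Real.rpow_le_one (one_sub_exp_nonneg hκ ht) ?_ hα.le
  linarith [Real.exp_pos (-(κ * t))]

lemma continuous_profile (hα : 0 < α) : Continuous (profile κ α) := by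
  unfold profile
  exact Continuous.rpow_const (by fun_prop) fun _ => Or.inr hα.le

lemma profile_mono (hκ : 0 < κ) (hα : 0 < α) {s t : ℝ} (hs : 0 ≤ s) (hst : s ≤ t) :
    profile κ α s ≤ profile κ α t := by
  refine Real.rpow_le_rpow (one_sub_exp_nonneg hκ hs) ?_ hα.le
  gcongr

lemma profileDeriv_nonneg (hκ : 0 < κ) (hα : 0 < α) {t : ℝ} (ht : 0 < t) :
    0 ≤ profileDeriv κ α t := by
  have := one_sub_exp_pos hκ ht
  unfold profileDeriv
  positivity

lemma hasDerivAt_one_sub_exp (κ t : ℝ) :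
    HasDerivAt (fun s : ℝ => 1 - Real.exp (-(κ * s))) (κ * Real.exp (-(κ * t))) t := by
  have h : HasDerivAt (fun s : ℝ => -(κ * s)) (-κ) t := by
    simpa using ((hasDerivAt_id t).const_mul κ).fun_neg
  simpa [mul_comm] using h.exp.const_sub 1

lemma hasDerivAt_profile (hκ : 0 < κ) {t : ℝ} (ht : 0 < t) :
    HasDerivAt (profile κ α) (profileDeriv κ α t) t := by
  have h := (hasDerivAt_one_sub_exp κ t).rpow_const (p := α) (Or.inl (one_sub_exp_pos hκ ht).ne')
  refine h.congr_deriv ?_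
  unfold profileDeriv
  ring

lemma hasDerivAt_profileDeriv (hκ : 0 < κ) {t : ℝ} (ht : 0 < t) :
    HasDerivAt (profileDeriv κ α) (profileDeriv2 κ α t) t := by
  have h1 := (hasDerivAt_one_sub_exp κ t).rpow_const (p := α - 1)
    (Or.inl (one_sub_exp_pos hκ ht).ne')
  have h2 : HasDerivAt (fun s : ℝ => κ * Real.exp (-(κ * s))) (-(κ * (κ * Real.exp (-(κ * t))))) t := by
    have h := ((hasDerivAt_one_sub_exp κ t).const_sub 1).const_mul κ
    simpa using h
  have h3 := (h1.const_mul α).mul h2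
  refine h3.congr_deriv ?_
  unfold profileDeriv2 profileDeriv
  rw [show α - 1 - 1 = α - 2 by ring]
  ring

lemma rpow_le_tangent (hα : 0 < α) (hα1 : α < 1) {p q : ℝ} (hp : 0 ≤ p) (hq : 0 < q) :
    p ^ α ≤ q ^ α + α * q ^ (α - 1) * (p - q) := by
  have h := rpow_one_add_le_one_add_mul_self (s := p / q - 1) (by
    have : 0 ≤ p / q := by positivity
    linarith) hα.le hα1.le
  rw [add_sub_cancel, Real.div_rpow hp hq.le, div_le_iff₀ (by positivity)] at h
  refine h.trans_eq ?_
  rw [Real.rpow_sub_one hq.ne']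
  field_simp

/-- Concavity, as a composition of the concave increasing `t ↦ t ^ α` (Bernoulli's inequality) with
the concave `1 - e^(-κ t)`. The endpoint `s = 0` is included. -/
lemma profile_le_tangent (hκ : 0 < κ) (hα : 0 < α) (hα1 : α < 1) {s d : ℝ} (hs : 0 ≤ s)
    (hd : 0 < d) : profile κ α s ≤ profile κ α d + profileDeriv κ α d * (s - d) := by
  have hP := one_sub_exp_pos hκ hd
  refine (rpow_le_tangent hα hα1 (one_sub_exp_nonneg hκ hs) hP).trans ?_
  have h1 : (1 - Real.exp (-(κ * s))) - (1 - Real.exp (-(κ * d))) ≤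
      κ * Real.exp (-(κ * d)) * (s - d) := by
    have h := Real.add_one_le_exp (-(κ * (s - d)))
    have h2 : Real.exp (-(κ * s)) = Real.exp (-(κ * d)) * Real.exp (-(κ * (s - d))) := by
      rw [← Real.exp_add]; ring_nf
    rw [h2]
    nlinarith [Real.exp_pos (-(κ * d))]
  unfold profile profileDeriv
  have h3 : 0 ≤ α * (1 - Real.exp (-(κ * d))) ^ (α - 1) := by positivity
  nlinarith [mul_le_mul_of_nonneg_left h1 h3]

/-- The tangent at `d` is nonnegative at `0`. The bound is uniform in `α`, which keeps `K`
independent of `α`. -/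
lemma profileDeriv_mul_le_one (hκ : 0 < κ) (hα : 0 < α) (hα1 : α < 1) {d : ℝ} (hd : 0 < d) :
    profileDeriv κ α d * d ≤ 1 := by
  have h := profile_le_tangent hκ hα hα1 le_rfl hd
  have h1 := profile_le_one (κ := κ) hκ hα hd.le
  rw [profile_zero hα] at h
  linarith

/-- The term `κ ψ'` cancels exactly. In the rest, `1 - e^(-κ d) ≤ κ d` is raised to the negative
power `α - 2`, and the surplus factor `κ ^ α` is at least `1`. -/
lemma profileDeriv2_add_le (hκ : 1 ≤ κ) (hα : 0 < α) (hα1 : α < 1) {d D : ℝ} (hd : 0 < d)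
    (hD : d ≤ D) :
    profileDeriv2 κ α d + κ * profileDeriv κ α d ≤
      -(α * (1 - α) * Real.exp (-(2 * κ * D)) * d ^ (α - 2)) := by
  have hκ0 : 0 < κ := by linarith
  have hP := one_sub_exp_pos hκ0 hd
  have hPle : 1 - Real.exp (-(κ * d)) ≤ κ * d := by
    linarith [Real.add_one_le_exp (-(κ * d))]
  have h1 : (κ * d) ^ (α - 2) ≤ (1 - Real.exp (-(κ * d))) ^ (α - 2) :=
    Real.rpow_le_rpow_of_nonpos hP hPle (by linarith)
  have h2 : d ^ (α - 2) * 1 ≤ (κ * d) ^ (α - 2) * κ ^ 2 := by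
    rw [Real.mul_rpow hκ0.le hd.le, Real.rpow_sub hκ0, mul_comm (_ / _), mul_assoc]
    gcongr
    rw [Real.rpow_two, div_mul_cancel₀ _ (by positivity)]
    exact Real.one_le_rpow hκ hα.le
  have h3 : Real.exp (-(2 * κ * D)) ≤ Real.exp (-(κ * d)) ^ 2 := by
    rw [← Real.exp_nat_mul]
    gcongr
    push_cast
    nlinarith
  have h4 : Real.exp (-(2 * κ * D)) * d ^ (α - 2) ≤
      (1 - Real.exp (-(κ * d))) ^ (α - 2) * (κ * Real.exp (-(κ * d))) ^ 2 := by
    calc Real.exp (-(2 * κ * D)) * d ^ (α - 2)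
        ≤ Real.exp (-(κ * d)) ^ 2 * ((κ * d) ^ (α - 2) * κ ^ 2) := by
          gcongr
          linarith
      _ ≤ Real.exp (-(κ * d)) ^ 2 * ((1 - Real.exp (-(κ * d))) ^ (α - 2) * κ ^ 2) := by gcongr
      _ = _ := by ring
  unfold profileDeriv2
  have h5 : 0 ≤ α * (1 - α) := mul_nonneg hα.le (by linarith)
  nlinarith [mul_le_mul_of_nonneg_left h4 h5]

end profile

/-! ### Second derivatives along lines at a touching point -/

section SecondDerivative

variable {E : Type*} [NormedAddCommGroup E] [NormedSpace ℝ E]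

lemma hasDerivAt_line {u : E → ℝ} {x e : E} {s : ℝ} (h : DifferentiableAt ℝ u (x + s • e)) :
    HasDerivAt (fun t : ℝ => u (x + t • e)) (fderiv ℝ u (x + s • e) e) s := by
  have h1 : HasDerivAt (fun t : ℝ => x + t • e) e s := by
    simpa using ((hasDerivAt_id s).smul_const e).const_add x
  exact h.hasFDerivAt.comp_hasDerivAt s h1

lemma tendsto_line (x e : E) : Tendsto (fun t : ℝ => x + t • e) (𝓝 0) (𝓝 x) := by
  have : Continuous (fun t : ℝ => x + t • e) := by fun_prop
  simpa using this.tendsto 0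

lemma eventually_hasDerivAt_line {u : E → ℝ} {x : E} (hu : ContDiffAt ℝ 2 u x) (e : E) :
    ∀ᶠ s in 𝓝 (0 : ℝ), HasDerivAt (fun t : ℝ => u (x + t • e)) (fderiv ℝ u (x + s • e) e) s := by
  have h := hu.eventually (by simp)
  filter_upwards [(tendsto_line x e).eventually h] with s hs
  exact hasDerivAt_line (hs.differentiableAt (by simp))

lemma hasDerivAt_fderiv_line {u : E → ℝ} {x : E} (hu : ContDiffAt ℝ 2 u x) (e : E) :
    HasDerivAt (fun t : ℝ => fderiv ℝ u (x + t • e) e) (iteratedFDeriv ℝ 2 u x ![e, e]) 0 := by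
  have h1 : DifferentiableAt ℝ (fderiv ℝ u) x :=
    (hu.fderiv_right (m := 1) (by norm_num)).differentiableAt (by simp)
  have h2 : HasDerivAt (fun t : ℝ => x + t • e) e 0 := by
    simpa using ((hasDerivAt_id (0 : ℝ)).smul_const e).const_add x
  have h3 : HasFDerivAt (fderiv ℝ u) (fderiv ℝ (fderiv ℝ u) x) (x + (0 : ℝ) • e) := by
    simpa using h1.hasFDerivAt
  have h4 : HasDerivAt (fun t : ℝ => fderiv ℝ u (x + t • e)) (fderiv ℝ (fderiv ℝ u) x e) 0 :=
    h3.comp_hasDerivAt 0 h2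
  rw [iteratedFDeriv_two_apply]
  exact (ContinuousLinearMap.apply ℝ ℝ e).hasFDerivAt.comp_hasDerivAt 0 h4

/-- If `b > 0`, the second derivative test makes `0` a local minimum as well, so `v` is locally
constant and `b = 0`. -/
lemma second_deriv_nonpos_of_isLocalMax {v v' : ℝ → ℝ} {b : ℝ}
    (hv : ∀ᶠ s in 𝓝 (0 : ℝ), HasDerivAt v (v' s) s) (hv' : HasDerivAt v' b 0)
    (hmax : IsLocalMax v 0) : b ≤ 0 := by
  by_contra! hb
  have hd : deriv v =ᶠ[𝓝 0] v' := hv.mono fun s hs => hs.deriv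
  have h0 : deriv v 0 = 0 := hmax.deriv_eq_zero
  have h2 : deriv (deriv v) 0 = b := by rw [hd.deriv_eq, hv'.deriv]
  have hmin := isLocalMin_of_deriv_deriv_pos (by rw [h2]; exact hb) h0 hv.self_of_nhds.continuousAt
  have hc : v =ᶠ[𝓝 0] fun _ => v 0 := by
    filter_upwards [hmax, hmin] with s h1 h2
    exact le_antisymm h1 h2
  have h3 : deriv (deriv v) 0 = 0 := by
    rw [hc.deriv.deriv_eq]
    simp
  linarith

/-- If `u - u x` is below `q - q 0` on a line through `x`, the second derivative of `u` in the
direction of the line is at most that of `q`. -/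
lemma iteratedFDeriv_two_le_of_touching {u : E → ℝ} {x e : E} (hu : ContDiffAt ℝ 2 u x)
    {q q' : ℝ → ℝ} {b : ℝ} (hq : ∀ᶠ s in 𝓝 (0 : ℝ), HasDerivAt q (q' s) s)
    (hq' : HasDerivAt q' b 0)
    (h : ∀ᶠ s in 𝓝 (0 : ℝ), u (x + s • e) - u x ≤ q s - q 0) :
    iteratedFDeriv ℝ 2 u x ![e, e] ≤ b := by
  have h1 : ∀ᶠ s in 𝓝 (0 : ℝ), HasDerivAt (fun t => u (x + t • e) - q t)
      (fderiv ℝ u (x + s • e) e - q' s) s := by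
    filter_upwards [hq, eventually_hasDerivAt_line hu e] with s h1 h2
    exact h2.sub h1
  have h2 := second_deriv_nonpos_of_isLocalMax h1 ((hasDerivAt_fderiv_line hu e).sub hq') (by
    filter_upwards [h] with s hs
    simp only [zero_smul, add_zero]
    linarith)
  linarith

end SecondDerivative

/-! ### Essential suprema of real functions -/

section EssSup

variable {X : Type*} [MeasurableSpace X] {μ : Measure X}

lemma essSup_nonneg_of_nonneg {f : X → ℝ} (hf : ∀ x, 0 ≤ f x) : 0 ≤ essSup f μ := by
  rw [essSup, limsup_eq]
  -- For the zero measure every real number is an essential bound, and `sInf univ = 0` in `ℝ`.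
  by_cases hμ : μ = 0
  · subst hμ
    simp
  · have : NeZero μ := ⟨hμ⟩
    refine Real.sInf_nonneg fun a ha => ?_
    obtain ⟨x, hx⟩ := (show ∀ᵐ x ∂μ, f x ≤ a from ha).exists
    exact (hf x).trans hx

lemma MeasureTheory.MemLp.exists_ae_norm_le {f : X → ℝ} (hf : MemLp f ∞ μ) :
    ∃ c : ℝ, 0 ≤ c ∧ ∀ᵐ x ∂μ, |f x| ≤ c := by
  refine ⟨(eLpNorm f ∞ μ).toReal, ENNReal.toReal_nonneg, ?_⟩
  filter_upwards [ae_le_eLpNormEssSup (f := f) (μ := μ)] with x hx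
  rw [← Real.norm_eq_abs, ← toReal_enorm]
  exact ENNReal.toReal_mono hf.2.ne (by rwa [eLpNorm_exponent_top])

lemma ae_le_essSup_of_ae_abs_le {f : X → ℝ} {c : ℝ} (hf : ∀ᵐ x ∂μ, |f x| ≤ c) :
    ∀ᵐ x ∂μ, f x ≤ essSup f μ :=
  ae_le_essSup ⟨c, hf.mono fun _ hx => (le_abs_self _).trans hx⟩

lemma ae_max_zero_le_essSup {f : X → ℝ} (hf : MemLp f ∞ μ) :
    ∀ᵐ x ∂μ, f x ≤ essSup (fun y => max (f y) 0) μ := by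
  obtain ⟨c, hc, h⟩ := hf.exists_ae_norm_le
  have h' : ∀ᵐ x ∂μ, |max (f x) 0| ≤ c := by
    filter_upwards [h] with x hx
    rw [abs_of_nonneg (le_max_right _ _)]
    exact max_le ((le_abs_self _).trans hx) hc
  filter_upwards [ae_le_essSup_of_ae_abs_le h'] with x hx
  exact (le_max_left _ _).trans hx

end EssSup

/-! ### Geometry of `C²` domains -/

section Geometry

variable {N : ℕ}

/-- The derivative is Lipschitz near `a₀`; the mean value inequality on the segment from `a` to `b`
gives a remainder uniform in both points. -/
lemma taylor_bound {V : Type*} [NormedAddCommGroup V] [NormedSpace ℝ V]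
    {γ : V → ℝ} {a₀ : V} (hγ : ContDiffAt ℝ 2 γ a₀) :
    ∃ s > 0, ∃ L : ℝ, 0 ≤ L ∧ (∀ a ∈ Metric.ball a₀ s, DifferentiableAt ℝ γ a) ∧
      ∀ a ∈ Metric.ball a₀ s, ∀ b ∈ Metric.ball a₀ s,
        |γ b - γ a - fderiv ℝ γ a (b - a)| ≤ L * ‖b - a‖ ^ 2 := by
  obtain ⟨L, t, ht, hL⟩ := (hγ.fderiv_right (m := 1) (by norm_num)).exists_lipschitzOnWith
  have hd : ∀ᶠ a in 𝓝 a₀, DifferentiableAt ℝ γ a :=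
    (hγ.eventually (by simp)).mono fun a ha => ha.differentiableAt (by simp)
  obtain ⟨s, hs, hst⟩ := Metric.mem_nhds_iff.1 (inter_mem ht hd)
  refine ⟨s, hs, L, L.2, fun a ha => (hst ha).2, fun a ha b hb => ?_⟩
  have hseg : segment ℝ a b ⊆ Metric.ball a₀ s := (convex_ball a₀ s).segment_subset ha hb
  have h := (convex_segment a b).norm_image_sub_le_of_norm_fderiv_le' (𝕜 := ℝ) (f := γ)
    (φ := fderiv ℝ γ a) (C := L * ‖b - a‖)
    (fun x hx => (hst (hseg hx)).2) (fun x hx => by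
      refine (hL.norm_sub_le (hst (hseg hx)).1 (hst ha).1).trans ?_
      gcongr
      exact norm_sub_le_of_mem_segment hx)
    (left_mem_segment ℝ a b) (right_mem_segment ℝ a b)
  rw [Real.norm_eq_abs] at h
  linarith

lemma eq_of_mem_frontier {Ω : Set (EuclideanSpace ℝ (Fin N))} (hΩ : IsOpen Ω)
    {ν x₀ p : EuclideanSpace ℝ (Fin N)} {r : ℝ} {γ : (ℝ ∙ ν)ᗮ → ℝ} (hγ : Continuous γ)
    (h : ∀ x ∈ Metric.ball x₀ r, x ∈ Ω ↔ γ ((ℝ ∙ ν)ᗮ.orthogonalProjectionOnto x) < ⟪ν, x⟫_ℝ)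
    (hp : p ∈ frontier Ω) (hpr : p ∈ Metric.ball x₀ r) :
    γ ((ℝ ∙ ν)ᗮ.orthogonalProjectionOnto p) = ⟪ν, p⟫_ℝ := by
  rw [hΩ.frontier_eq] at hp
  refine le_antisymm ?_ (not_lt.1 fun hlt => hp.2 ((h p hpr).2 hlt))
  by_contra! hlt
  have h1 : ∀ᶠ x in 𝓝 p, ⟪ν, x⟫_ℝ < γ ((ℝ ∙ ν)ᗮ.orthogonalProjectionOnto x) :=
    ContinuousAt.eventually_lt (by fun_prop) (by fun_prop) hlt
  have h2 := (mem_closure_iff_frequently.1 hp.1).and_eventually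
    (h1.and (Metric.isOpen_ball.mem_nhds hpr))
  obtain ⟨x, hx, hx1, hx2⟩ := h2.exists
  exact lt_asymm hx1 ((h x hx2).1 hx)

/-- A `C²` domain lies, uniformly near a boundary point, above paraboloids touching at the boundary
points. -/
lemma exists_local_normal {Ω : Set (EuclideanSpace ℝ (Fin N))} (hΩ : IsOpen Ω)
    (hC2 : HasC2Boundary Ω) {x₀ : EuclideanSpace ℝ (Fin N)} (hx₀ : x₀ ∈ frontier Ω) :
    ∃ s > 0, ∃ k > 0, ∀ p ∈ frontier Ω ∩ Metric.ball x₀ s,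
      ∃ n : EuclideanSpace ℝ (Fin N), ‖n‖ = 1 ∧ ∀ y ∈ Ω, -(k * ‖y - p‖ ^ 2) ≤ ⟪y - p, n⟫_ℝ := by
  obtain ⟨ν, r, γ, hν, hr, hγ, h⟩ := hC2 x₀ hx₀
  set P := (ℝ ∙ ν)ᗮ.orthogonalProjectionOnto with hP
  have hPle : ∀ v, ‖P v‖ ≤ ‖v‖ := fun v => Submodule.norm_orthogonalProjectionOnto_apply_le _ v
  obtain ⟨s₁, hs₁, L, hL, -, hTay⟩ := taylor_bound (hγ.contDiffAt (x := P x₀))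
  -- The half leaves room for points within `s` of `p`, itself within `s` of `x₀`.
  set s := min r s₁ / 2 with hs
  have hs0 : 0 < s := by positivity
  refine ⟨s, hs0, L + 1 / s, by positivity, fun p ⟨hp, hps⟩ => ?_⟩
  have hpx : ‖p - x₀‖ < s := by simpa [dist_eq_norm] using hps
  have hsr : 2 * s ≤ r := by rw [hs]; linarith [min_le_left r s₁]
  have hss : 2 * s ≤ s₁ := by rw [hs]; linarith [min_le_right r s₁]
  have hball : ∀ y, ‖y - x₀‖ < 2 * s → P y ∈ Metric.ball (P x₀) s₁ := fun y hy => by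
    rw [mem_ball_iff_norm, ← map_sub]
    exact (hPle _).trans_lt (hy.trans_le hss)
  have hpeq := eq_of_mem_frontier hΩ hγ.continuous h hp (by
    rw [mem_ball_iff_norm]; linarith)
  -- `g` is the gradient of `γ` at `P p`, so `m = ν - g` is normal to the graph and points into `Ω`;
  -- since `g ⊥ ν`, its norm is at least `1`.
  set g : (ℝ ∙ ν)ᗮ := (InnerProductSpace.toDual ℝ _).symm (fderiv ℝ γ (P p)) with hg
  set m : EuclideanSpace ℝ (Fin N) := ν - g with hm
  have hνg : ⟪ν, (g : EuclideanSpace ℝ (Fin N))⟫_ℝ = 0 :=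
    Submodule.mem_orthogonal_singleton_iff_inner_right.1 g.2
  have hm1 : 1 ≤ ‖m‖ := by
    have h1 : ⟪ν, m⟫_ℝ = 1 := by
      rw [hm, inner_sub_right, hνg, real_inner_self_eq_norm_sq, hν]; norm_num
    have h2 := real_inner_le_norm ν m
    rw [h1, hν, one_mul] at h2
    exact h2
  have hm0 : 0 < ‖m‖ := by linarith
  refine ⟨‖m‖⁻¹ • m, by rw [norm_smul, norm_inv, norm_norm, inv_mul_cancel₀ hm0.ne'],
    fun y hy => ?_⟩
  -- Far from `p`, where the chart says nothing, Cauchy–Schwarz and `1 ≤ ‖y - p‖ / s` suffice; this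
  -- is the share `1 / s` of the constant.
  by_cases hfar : s ≤ ‖y - p‖
  · have h1 := abs_real_inner_le_norm (y - p) (‖m‖⁻¹ • m)
    rw [norm_smul, norm_inv, norm_norm, inv_mul_cancel₀ hm0.ne', mul_one] at h1
    have h2 := (abs_le.1 h1).1
    have h3 : ‖y - p‖ ≤ 1 / s * ‖y - p‖ ^ 2 := by
      rw [one_div, ← div_eq_inv_mul, le_div_iff₀ hs0]
      nlinarith [norm_nonneg (y - p)]
    nlinarith [sq_nonneg ‖y - p‖]
  · push Not at hfar
    have hyx : ‖y - x₀‖ < 2 * s := by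
      have := norm_add_le (y - p) (p - x₀)
      rw [sub_add_sub_cancel] at this
      linarith
    have h1 := (h y (by rw [mem_ball_iff_norm]; linarith)).1 hy
    have h2 := (abs_le.1 (hTay (P p) (hball p (by linarith)) (P y) (hball y hyx))).1
    have h3 : fderiv ℝ γ (P p) (P y - P p) = ⟪y - p, (g : EuclideanSpace ℝ (Fin N))⟫_ℝ := by
      rw [← InnerProductSpace.toDual_symm_apply (𝕜 := ℝ), ← hg, ← map_sub,
        Submodule.inner_orthogonalProjectionOnto_eq_of_mem_left, real_inner_comm]
    have h4 : ‖P y - P p‖ ^ 2 ≤ ‖y - p‖ ^ 2 := by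
      rw [← map_sub]
      exact pow_le_pow_left₀ (norm_nonneg _) (hPle _) 2
    have h5 : -(L * ‖y - p‖ ^ 2) ≤ ⟪y - p, m⟫_ℝ := by
      have h6 : ⟪y - p, m⟫_ℝ = ⟪ν, y⟫_ℝ - ⟪ν, p⟫_ℝ - ⟪y - p, (g : EuclideanSpace ℝ (Fin N))⟫_ℝ := by
        rw [hm, inner_sub_right, real_inner_comm ν, inner_sub_right]
      rw [h6, ← h3]
      nlinarith [mul_le_mul_of_nonneg_left h4 hL]
    rw [inner_smul_right]
    have h7 : ‖m‖⁻¹ ≤ 1 := inv_le_one_of_one_le₀ hm1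
    have h8 : 0 ≤ ‖m‖⁻¹ := by positivity
    have h9 : 0 ≤ L * ‖y - p‖ ^ 2 := by positivity
    have h10 : 0 ≤ 1 / s * ‖y - p‖ ^ 2 := by positivity
    have h11 := mul_le_mul_of_nonneg_left h5 h8
    have h12 := mul_le_mul_of_nonneg_right h7 h9
    rw [mul_neg] at h11
    rw [add_mul]
    linarith

/-- Compactness of the boundary: the local constants add under finite unions. -/
lemma exists_uniform_normal {Ω : Set (EuclideanSpace ℝ (Fin N))} (hΩ : IsOpen Ω)
    (hb : Bornology.IsBounded Ω) (hC2 : HasC2Boundary Ω) :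
    ∃ k > 0, ∀ p ∈ frontier Ω,
      ∃ n : EuclideanSpace ℝ (Fin N), ‖n‖ = 1 ∧ ∀ y ∈ Ω, -(k * ‖y - p‖ ^ 2) ≤ ⟪y - p, n⟫_ℝ := by
  have hcomp : IsCompact (frontier Ω) :=
    hb.isCompact_closure.of_isClosed_subset isClosed_frontier frontier_subset_closure
  refine hcomp.induction_on (p := fun S => ∃ k > 0, ∀ p ∈ S,
      ∃ n : EuclideanSpace ℝ (Fin N), ‖n‖ = 1 ∧ ∀ y ∈ Ω, -(k * ‖y - p‖ ^ 2) ≤ ⟪y - p, n⟫_ℝ)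
    ⟨1, one_pos, by simp⟩ ?_ ?_ ?_
  · rintro S T hST ⟨k, hk, h⟩
    exact ⟨k, hk, fun p hp => h p (hST hp)⟩
  · rintro S T ⟨k, hk, h⟩ ⟨l, hl, h'⟩
    refine ⟨k + l, by positivity, ?_⟩
    rintro p (hp | hp)
    · obtain ⟨n, hn, hy⟩ := h p hp
      refine ⟨n, hn, fun y hyΩ => ?_⟩
      nlinarith [hy y hyΩ, mul_nonneg hl.le (sq_nonneg ‖y - p‖)]
    · obtain ⟨n, hn, hy⟩ := h' p hp
      refine ⟨n, hn, fun y hyΩ => ?_⟩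
      nlinarith [hy y hyΩ, mul_nonneg hk.le (sq_nonneg ‖y - p‖)]
  · intro x hx
    obtain ⟨s, hs, k, hk, h⟩ := exists_local_normal hΩ hC2 hx
    exact ⟨_, inter_mem_nhdsWithin _ (Metric.ball_mem_nhds x hs), k, hk, h⟩

lemma nontrivial_euclidean (hN : 1 ≤ N) : Nontrivial (EuclideanSpace ℝ (Fin N)) := by
  have : Nonempty (Fin N) := ⟨⟨0, hN⟩⟩
  infer_instance

lemma compl_nonempty_of_isBounded (hN : 1 ≤ N) {Ω : Set (EuclideanSpace ℝ (Fin N))}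
    (hb : Bornology.IsBounded Ω) : Ωᶜ.Nonempty := by
  have := nontrivial_euclidean hN
  refine nonempty_compl.2 fun hu => ?_
  rw [hu] at hb
  exact NoncompactSpace.noncompact_univ (X := EuclideanSpace ℝ (Fin N))
    (by simpa using hb.isCompact_closure)

lemma continuous_distCompl (Ω : Set (EuclideanSpace ℝ (Fin N))) : Continuous (distCompl Ω) :=
  Metric.continuous_infDist_pt _

lemma distCompl_nonneg (Ω : Set (EuclideanSpace ℝ (Fin N))) (x : EuclideanSpace ℝ (Fin N)) :
    0 ≤ distCompl Ω x :=
  Metric.infDist_nonneg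

lemma distCompl_pos (hN : 1 ≤ N) {Ω : Set (EuclideanSpace ℝ (Fin N))} (hΩ : IsOpen Ω)
    (hb : Bornology.IsBounded Ω) {x : EuclideanSpace ℝ (Fin N)} (hx : x ∈ Ω) :
    0 < distCompl Ω x :=
  (hΩ.isClosed_compl.notMem_iff_infDist_pos (compl_nonempty_of_isBounded hN hb)).1
    (by simpa using hx)

lemma exists_distCompl_le {Ω : Set (EuclideanSpace ℝ (Fin N))} (hb : Bornology.IsBounded Ω) :
    ∃ D : ℝ, 1 ≤ D ∧ ∀ x ∈ Ω, distCompl Ω x ≤ D := by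
  obtain ⟨D, hD⟩ := hb.isCompact_closure.exists_bound_of_continuousOn
    (continuous_distCompl Ω).continuousOn
  exact ⟨max 1 D, le_max_left _ _, fun x hx =>
    ((le_abs_self _).trans (hD x (subset_closure hx))).trans (le_max_right _ _)⟩

/-- Uniform exterior ball condition, with the resulting upper bound for the distance function. -/
lemma exists_exterior_balls (hN : 1 ≤ N) {Ω : Set (EuclideanSpace ℝ (Fin N))} (hΩ : IsOpen Ω)
    (hb : Bornology.IsBounded Ω) (hC2 : HasC2Boundary Ω) :
    ∃ ρ : ℝ, 0 < ρ ∧ ρ ≤ 1 ∧ ∀ x ∈ Ω, ∃ p c : EuclideanSpace ℝ (Fin N),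
      ‖x - p‖ = distCompl Ω x ∧ ‖p - c‖ = ρ ∧ ‖x - c‖ = distCompl Ω x + ρ ∧
      ∀ y ∈ closure Ω, distCompl Ω y + ρ ≤ ‖y - c‖ := by
  obtain ⟨k, hk, h⟩ := exists_uniform_normal hΩ hb hC2
  have hΩne := compl_nonempty_of_isBounded hN hb
  set ρ := min 1 (1 / (2 * k)) with hρ
  have hρ0 : 0 < ρ := by positivity
  have hρk : 2 * ρ * k ≤ 1 := by
    have := min_le_right 1 (1 / (2 * k))
    rw [← hρ, le_div_iff₀ (by positivity)] at this
    linarith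
  refine ⟨ρ, hρ0, min_le_left _ _, fun x hx => ?_⟩
  obtain ⟨p, hp, hxp⟩ := exists_mem_frontier_infDist_compl_eq_dist hx (nonempty_compl.1 hΩne)
  obtain ⟨n, hn, hy⟩ := h p hp
  have hxp' : ‖x - p‖ = distCompl Ω x := by rw [distCompl, hxp, dist_eq_norm]
  have hfar : ∀ y ∈ Ω, ρ ≤ ‖y - (p - ρ • n)‖ := fun y hyΩ => by
    have h1 : ‖y - (p - ρ • n)‖ ^ 2 = ‖y - p‖ ^ 2 + 2 * (ρ * ⟪y - p, n⟫_ℝ) + ρ ^ 2 := by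
      rw [← sub_add, norm_add_sq_real, inner_smul_right, norm_smul, hn, Real.norm_of_nonneg hρ0.le,
        mul_one]
    refine le_of_sq_le_sq ?_ (norm_nonneg _)
    rw [h1]
    nlinarith [hy y hyΩ, mul_le_mul_of_nonneg_left (hy y hyΩ) hρ0.le,
      mul_le_mul_of_nonneg_right hρk (sq_nonneg ‖y - p‖)]
  -- The ball of radius `δ(y)` about `y` lies in `Ω` and so misses the exterior ball; disjoint balls
  -- have centres at distance at least the sum of the radii.
  have hmain : ∀ y ∈ Ω, distCompl Ω y + ρ ≤ ‖y - (p - ρ • n)‖ := fun y hyΩ => by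
    have hd := distCompl_pos hN hΩ hb hyΩ
    rw [← dist_eq_norm, ← disjoint_ball_ball_iff hd hρ0, Set.disjoint_left]
    intro z hz1 hz2
    have hzΩ : z ∈ Ω := by
      by_contra hz
      have := Metric.infDist_le_dist_of_mem (x := y) (show z ∈ Ωᶜ from hz)
      rw [Metric.mem_ball, dist_comm] at hz1
      exact absurd hz1 (not_lt.2 this)
    have := hfar z hzΩ
    rw [Metric.mem_ball, dist_eq_norm] at hz2
    linarith
  refine ⟨p, p - ρ • n, hxp', ?_, ?_, ?_⟩
  · rw [sub_sub_cancel, norm_smul, hn, Real.norm_of_nonneg hρ0.le, mul_one]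
  · refine le_antisymm ?_ (hmain x hx)
    rw [← sub_add]
    refine (norm_add_le _ _).trans ?_
    rw [hxp', norm_smul, hn, Real.norm_of_nonneg hρ0.le, mul_one]
  · intro y hyc
    have hcl : IsClosed {y | distCompl Ω y + ρ ≤ ‖y - (p - ρ • n)‖} :=
      isClosed_le ((continuous_distCompl Ω).add continuous_const) (by fun_prop)
    exact closure_minimal hmain hcl hyc

/-- Orthogonal projection to the hyperplane is `1`-Lipschitz, so it does not increase Hausdorff
measure, and the image of a piece of the graph contains a neighbourhood in an `(N - 1)`-dimensional
space. -/
lemma hausdorffMeasure_frontier_pos (hN : 1 ≤ N) {Ω : Set (EuclideanSpace ℝ (Fin N))}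
    (hΩ : IsOpen Ω) (hC2 : HasC2Boundary Ω) {p : EuclideanSpace ℝ (Fin N)}
    (hp : p ∈ frontier Ω) {U : Set (EuclideanSpace ℝ (Fin N))} (hU : U ∈ 𝓝 p) :
    0 < Measure.hausdorffMeasure ((N : ℝ) - 1) (frontier Ω ∩ U) := by
  obtain ⟨ν, r, γ, hν, hr, hγ, h⟩ := hC2 p hp
  set P := (ℝ ∙ ν)ᗮ.orthogonalProjectionOnto with hP
  have hpeq := eq_of_mem_frontier hΩ hγ.continuous h hp (Metric.mem_ball_self hr)
  have hPν : P ν = 0 := by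
    rw [hP, Submodule.orthogonalProjectionOnto_eq_zero_iff]
    exact Submodule.le_orthogonal_orthogonal _ (Submodule.mem_span_singleton_self ν)
  have hPq : ∀ (q : (ℝ ∙ ν)ᗮ) (t : ℝ), P ((q : EuclideanSpace ℝ (Fin N)) + t • ν) = q :=
    fun q t => by
      rw [map_add, map_smul, hPν, smul_zero, add_zero, hP,
        Submodule.orthogonalProjectionOnto_mem_subspace_eq_self]
  have hνq : ∀ (q : (ℝ ∙ ν)ᗮ) (t : ℝ), ⟪ν, (q : EuclideanSpace ℝ (Fin N)) + t • ν⟫_ℝ = t :=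
    fun q t => by
      rw [inner_add_right, Submodule.mem_orthogonal_singleton_iff_inner_right.1 q.2,
        inner_smul_right, real_inner_self_eq_norm_sq, hν]
      norm_num
  have hdecomp : ((P p : (ℝ ∙ ν)ᗮ) : EuclideanSpace ℝ (Fin N)) + γ (P p) • ν = p := by
    rw [hpeq, hP, Submodule.orthogonalProjectionOnto_orthogonal]
    change p - (ℝ ∙ ν).starProjection p + ⟪ν, p⟫_ℝ • ν = p
    rw [Submodule.starProjection_unit_singleton ℝ hν, sub_add_cancel]
  have hcont : Continuous fun q : (ℝ ∙ ν)ᗮ => (q : EuclideanSpace ℝ (Fin N)) + γ q • ν :=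
    continuous_subtype_val.add (hγ.continuous.smul continuous_const)
  have hV : (fun q : (ℝ ∙ ν)ᗮ => (q : EuclideanSpace ℝ (Fin N)) + γ q • ν) ⁻¹'
      (U ∩ Metric.ball p r) ∈ 𝓝 (P p) := by
    refine hcont.continuousAt ?_
    rw [hdecomp]
    exact inter_mem hU (Metric.ball_mem_nhds p hr)
  set W := (fun q : (ℝ ∙ ν)ᗮ => (q : EuclideanSpace ℝ (Fin N)) + γ q • ν) ⁻¹'
      (U ∩ Metric.ball p r) with hW
  have hsub : W ⊆ P '' (frontier Ω ∩ U) := by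
    intro q hq
    refine ⟨(q : EuclideanSpace ℝ (Fin N)) + γ q • ν, ⟨?_, hq.1⟩, hPq _ _⟩
    rw [hΩ.frontier_eq]
    refine ⟨?_, fun hmem => ?_⟩
    · have ht : Tendsto (fun t : ℝ => (q : EuclideanSpace ℝ (Fin N)) + t • ν) (𝓝[>] (γ q))
          (𝓝 ((q : EuclideanSpace ℝ (Fin N)) + γ q • ν)) :=
        (Continuous.tendsto (by fun_prop) _).mono_left nhdsWithin_le_nhds
      refine mem_closure_of_tendsto ht ?_
      filter_upwards [self_mem_nhdsWithin, ht.eventually (Metric.isOpen_ball.mem_nhds hq.2)]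
        with t ht1 ht2
      rw [h _ ht2, hPq, hνq]
      exact ht1
    · have := (h _ hq.2).1 hmem
      rw [hPq, hνq] at this
      exact lt_irrefl _ this
  have hfin : (Module.finrank ℝ (ℝ ∙ ν)ᗮ : ℝ) = (N : ℝ) - 1 := by
    have hν0 : ν ≠ 0 := by
      rintro rfl
      simp at hν
    have h1 := Submodule.finrank_add_finrank_orthogonal (ℝ ∙ ν)
    rw [finrank_span_singleton hν0, finrank_euclideanSpace_fin] at h1
    have h2 : (N : ℝ) = 1 + (Module.finrank ℝ (ℝ ∙ ν)ᗮ : ℝ) := by exact_mod_cast h1.symm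
    linarith
  have h1 : 0 < Measure.hausdorffMeasure (Module.finrank ℝ (ℝ ∙ ν)ᗮ : ℝ) W :=
    Measure.measure_pos_of_mem_nhds _ hV
  rw [hfin] at h1
  have h2 := (Submodule.lipschitzWith_orthogonalProjectionOnto (ℝ ∙ ν)ᗮ).hausdorffMeasure_image_le
    (d := (N : ℝ) - 1) (by simpa using hN) (frontier Ω ∩ U)
  rw [ENNReal.coe_one, ENNReal.one_rpow, one_mul] at h2
  exact h1.trans_le ((measure_mono hsub).trans h2)

/-- Turns the almost everywhere boundary inequality into one at every boundary point: by continuity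
a violation would persist on a set of positive surface measure. -/
lemma le_essSup_on_frontier (hN : 1 ≤ N) {Ω : Set (EuclideanSpace ℝ (Fin N))}
    (hΩ : IsOpen Ω) (hC2 : HasC2Boundary Ω) {w g : EuclideanSpace ℝ (Fin N) → ℝ}
    (hw : ContinuousOn w (closure Ω)) (hg : MemLp g ∞ (bdryMeasure Ω))
    (hwg : ∀ᵐ x ∂(bdryMeasure Ω), w x ≤ g x) {p : EuclideanSpace ℝ (Fin N)}
    (hp : p ∈ frontier Ω) : w p ≤ essSup (fun y => max (g y) 0) (bdryMeasure Ω) := by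
  by_contra! hlt
  set M := essSup (fun y => max (g y) 0) (bdryMeasure Ω)
  have h1 : ∀ᵐ x ∂(bdryMeasure Ω), w x ≤ M := by
    filter_upwards [hwg, ae_max_zero_le_essSup hg] with x h1 h2
    exact h1.trans h2
  have h2 : ∀ᶠ x in 𝓝[closure Ω] p, M < w x :=
    (hw p (frontier_subset_closure hp)).eventually_const_lt hlt
  obtain ⟨U, hU, hUsub⟩ := mem_nhdsWithin_iff_exists_mem_nhds_inter.1 h2
  have h3 := hausdorffMeasure_frontier_pos hN hΩ hC2 hp hU
  rw [bdryMeasure, ae_restrict_iff' isClosed_frontier.measurableSet] at h1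
  refine h3.ne' (measure_mono_null ?_ (ae_iff.1 h1))
  rintro x ⟨hx, hxU⟩
  simp only [Classical.not_imp, not_le, mem_ofPred_eq]
  exact ⟨hx, hUsub ⟨hxU, frontier_subset_closure hx⟩⟩

end Geometry

/-! ### Integrability and scaling of the kernels -/

/-- The kernel `|z|^{-N-2σ}` of the fractional Laplacian. -/
noncomputable def fracKernel (N : ℕ) (σ : ℝ) (z : EuclideanSpace ℝ (Fin N)) : ℝ :=
  (‖z‖ ^ ((N : ℝ) + 2 * σ))⁻¹

/-- The kernel `max(|z|, r)^{-N-2σ}`. -/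
noncomputable def truncKernel (N : ℕ) (σ r : ℝ) (z : EuclideanSpace ℝ (Fin N)) : ℝ :=
  ((max ‖z‖ r) ^ ((N : ℝ) + 2 * σ))⁻¹

/-- The second difference `2 w(x) - w(x + z) - w(x - z)`. -/
def secondDiff {N : ℕ} (w : EuclideanSpace ℝ (Fin N) → ℝ) (x z : EuclideanSpace ℝ (Fin N)) : ℝ :=
  2 * w x - w (x + z) - w (x + -z)

section Kernel

variable {N : ℕ} {σ : ℝ}

lemma fracKernel_nonneg (z : EuclideanSpace ℝ (Fin N)) : 0 ≤ fracKernel N σ z := by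
  unfold fracKernel; positivity

lemma measurable_fracKernel : Measurable (fracKernel N σ) := by
  unfold fracKernel; fun_prop

lemma fracKernel_neg (z : EuclideanSpace ℝ (Fin N)) : fracKernel N σ (-z) = fracKernel N σ z := by
  simp [fracKernel]

lemma truncKernel_neg {r : ℝ} (z : EuclideanSpace ℝ (Fin N)) :
    truncKernel N σ r (-z) = truncKernel N σ r z := by
  simp [truncKernel]

lemma truncKernel_nonneg {r : ℝ} (z : EuclideanSpace ℝ (Fin N)) : 0 ≤ truncKernel N σ r z := by
  have : 0 ≤ max ‖z‖ r := le_max_of_le_left (norm_nonneg z)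
  unfold truncKernel; positivity

lemma truncKernel_eq {r : ℝ} {z : EuclideanSpace ℝ (Fin N)} (h : r ≤ ‖z‖) :
    truncKernel N σ r z = fracKernel N σ z := by
  rw [truncKernel, max_eq_left h, fracKernel]

lemma truncKernel_le (hσ : 0 < σ) {r : ℝ} {z : EuclideanSpace ℝ (Fin N)} (hz : z ≠ 0) :
    truncKernel N σ r z ≤ fracKernel N σ z := by
  have : 0 < ‖z‖ := norm_pos_iff.2 hz
  exact inv_anti₀ (Real.rpow_pos_of_pos this _)
    (Real.rpow_le_rpow this.le (le_max_left _ _)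
      (add_nonneg N.cast_nonneg (mul_nonneg zero_le_two hσ.le)))

lemma continuous_truncKernel {r : ℝ} (hr : 0 < r) :
    Continuous (truncKernel N σ r) := by
  have h : ∀ z : EuclideanSpace ℝ (Fin N), 0 < max ‖z‖ r := fun z => lt_max_of_lt_right hr
  unfold truncKernel
  refine Continuous.inv₀ (Continuous.rpow_const (by fun_prop) fun z => Or.inl (h z).ne')
    fun z => (Real.rpow_pos_of_pos (h z) _).ne'

lemma truncKernel_le_one_add_norm (hσ : 0 < σ) {r : ℝ} (hr : 0 < r)
    (z : EuclideanSpace ℝ (Fin N)) :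
    truncKernel N σ r z ≤
      (1 + 1 / r) ^ ((N : ℝ) + 2 * σ) * (1 + ‖z‖) ^ (-((N : ℝ) + 2 * σ)) := by
  have h : 0 < max ‖z‖ r := lt_max_of_lt_right hr
  have h1 : 0 < 1 + ‖z‖ := by positivity
  rw [Real.rpow_neg h1.le, ← div_eq_mul_inv, truncKernel, inv_eq_one_div,
    div_le_div_iff₀ (by positivity) (by positivity), one_mul,
    ← Real.mul_rpow (by positivity) h.le]
  refine Real.rpow_le_rpow h1.le ?_ (by positivity)
  have h2 : 1 ≤ 1 / r * max ‖z‖ r := by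
    rw [one_div, ← div_eq_inv_mul, one_le_div hr]
    exact le_max_right _ _
  have h3 := le_max_left ‖z‖ r
  linarith

lemma integrable_truncKernel (hσ : 0 < σ) {r : ℝ} (hr : 0 < r) :
    Integrable (truncKernel N σ r) := by
  have h := (integrable_one_add_norm (E := EuclideanSpace ℝ (Fin N)) (μ := volume)
    (r := (N : ℝ) + 2 * σ) (by simpa using hσ)).const_mul ((1 + 1 / r) ^ ((N : ℝ) + 2 * σ))
  refine h.mono' (continuous_truncKernel hr).aestronglyMeasurable (Eventually.of_forall fun z => ?_)
  rw [Real.norm_of_nonneg (truncKernel_nonneg z)]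
  exact truncKernel_le_one_add_norm hσ hr z

/-- In polar coordinates the integrand is `t^(1-2σ)` near `0` and `t^(-1-2σ)` at infinity. -/
lemma integrable_min_mul_fracKernel (hN : 1 ≤ N) (hσ₀ : 0 < σ) (hσ₁ : σ < 1) :
    Integrable fun z : EuclideanSpace ℝ (Fin N) => min 1 (‖z‖ ^ 2) * fracKernel N σ z := by
  have := nontrivial_euclidean hN
  unfold fracKernel
  refine (integrable_fun_norm_addHaar (volume : Measure (EuclideanSpace ℝ (Fin N)))
    (f := fun t : ℝ => min 1 (t ^ 2) * (t ^ ((N : ℝ) + 2 * σ))⁻¹)).2 ?_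
  rw [finrank_euclideanSpace_fin, ← Ioc_union_Ioi_eq_Ioi zero_le_one]
  have hpow : ∀ t : ℝ, 0 < t → t ^ (N - 1) = t ^ ((N : ℝ) - 1) := fun t ht => by
    rw [← Real.rpow_natCast, Nat.cast_sub hN, Nat.cast_one]
  refine IntegrableOn.union ?_ ?_
  · have h : IntegrableOn (fun t : ℝ => t ^ (1 - 2 * σ)) (Ioc 0 1) :=
      (intervalIntegrable_iff_integrableOn_Ioc_of_le zero_le_one).1
        (intervalIntegral.intervalIntegrable_rpow' (by linarith))
    refine h.congr_fun (fun t ht => ?_) measurableSet_Ioc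
    have h1 : t ^ 2 ≤ 1 := pow_le_one₀ ht.1.le ht.2
    simp only [smul_eq_mul]
    rw [hpow t ht.1, min_eq_right h1, ← Real.rpow_two, ← Real.rpow_neg ht.1.le,
      ← Real.rpow_add ht.1, ← Real.rpow_add ht.1]
    congr 1
    ring
  · refine (integrableOn_Ioi_rpow_of_lt (a := -1 - 2 * σ) (by linarith) one_pos).congr_fun
      (fun t ht => ?_) measurableSet_Ioi
    have ht1 : (1 : ℝ) < t := ht
    have ht0 : 0 < t := by linarith
    have h1 : 1 ≤ t ^ 2 := one_le_pow₀ ht1.le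
    simp only [smul_eq_mul]
    rw [hpow t ht0, min_eq_left h1, one_mul, ← Real.rpow_neg ht0.le, ← Real.rpow_add ht0]
    congr 1
    ring

lemma min_mul_fracKernel_smul {d : ℝ} (hd : 0 < d) (z : EuclideanSpace ℝ (Fin N)) :
    min 1 (‖d • z‖ ^ 2 / d ^ 2) * fracKernel N σ (d • z) =
      (d ^ ((N : ℝ) + 2 * σ))⁻¹ * (min 1 (‖z‖ ^ 2) * fracKernel N σ z) := by
  rw [fracKernel, fracKernel, norm_smul, Real.norm_of_nonneg hd.le,
    Real.mul_rpow hd.le (norm_nonneg z), mul_pow, mul_div_cancel_left₀ _ (by positivity), mul_inv]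
  ring

lemma integrable_scaled_min_mul_fracKernel (hN : 1 ≤ N) (hσ₀ : 0 < σ) (hσ₁ : σ < 1) {d : ℝ}
    (hd : 0 < d) :
    Integrable fun z : EuclideanSpace ℝ (Fin N) => min 1 (‖z‖ ^ 2 / d ^ 2) * fracKernel N σ z := by
  rw [← integrable_comp_smul_iff volume _ hd.ne']
  simp_rw [min_mul_fracKernel_smul hd]
  exact (integrable_min_mul_fracKernel hN hσ₀ hσ₁).const_mul _

lemma integral_scaled_min_mul_fracKernel {d : ℝ} (hd : 0 < d) :
    ∫ z : EuclideanSpace ℝ (Fin N), min 1 (‖z‖ ^ 2 / d ^ 2) * fracKernel N σ z =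
      d ^ (-(2 * σ)) * ∫ z : EuclideanSpace ℝ (Fin N), min 1 (‖z‖ ^ 2) * fracKernel N σ z := by
  have h := Measure.integral_comp_smul (volume : Measure (EuclideanSpace ℝ (Fin N)))
    (fun z => min 1 (‖z‖ ^ 2 / d ^ 2) * fracKernel N σ z) d
  simp_rw [min_mul_fracKernel_smul hd] at h
  rw [integral_const_mul, finrank_euclideanSpace_fin, abs_of_pos (by positivity), smul_eq_mul,
    Real.rpow_add hd, Real.rpow_natCast] at h
  rw [Real.rpow_neg hd.le]
  field_simp at h ⊢
  linarith

/-- The kernel is at least `(3d)^(-N-2σ)` on a ball of volume proportional to `(θ d)^N`. The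
resulting power `d^(-2σ)` matches `integral_scaled_min_mul_fracKernel`. -/
lemma fracKernel_integral_ball_ge (hN : 1 ≤ N) (hσ : 0 < σ) {d θ : ℝ} (hd : 0 < d) (hθ : 0 < θ)
    {e : EuclideanSpace ℝ (Fin N)} (hball : ∀ z ∈ Metric.ball e (θ * d), d ≤ ‖z‖ ∧ ‖z‖ ≤ 3 * d) :
    IntegrableOn (fracKernel N σ) (Metric.ball e (θ * d)) ∧
    d ^ (-(2 * σ)) * (volume.real (Metric.ball (0 : EuclideanSpace ℝ (Fin N)) 1) * θ ^ N *
        ((3 : ℝ) ^ ((N : ℝ) + 2 * σ))⁻¹) ≤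
      ∫ z in Metric.ball e (θ * d), fracKernel N σ z := by
  have := nontrivial_euclidean hN
  have hint : IntegrableOn (fracKernel N σ) (Metric.ball e (θ * d)) := by
    refine (integrable_truncKernel hσ hd).integrableOn.congr_fun (fun z hz => ?_) measurableSet_ball
    exact truncKernel_eq (hball z hz).1
  refine ⟨hint, ?_⟩
  have h1 := setIntegral_ge_of_const_le_real (μ := volume)
    (c := ((3 * d) ^ ((N : ℝ) + 2 * σ))⁻¹) measurableSet_ball
    (measure_ball_lt_top (x := e) (r := θ * d)).ne (fun z hz => ?_) hint
  · refine le_trans (le_of_eq ?_) h1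
    rw [measureReal_def volume (Metric.ball e (θ * d)),
      Measure.addHaar_ball _ _ (by positivity : 0 ≤ θ * d),
      ENNReal.toReal_mul, ENNReal.toReal_ofReal (by positivity), finrank_euclideanSpace_fin,
      Real.mul_rpow (by norm_num) hd.le, Real.rpow_add hd, Real.rpow_natCast, Real.rpow_neg hd.le,
      mul_pow, ← measureReal_def]
    field_simp
  · have hz0 : 0 < ‖z‖ := hd.trans_le (hball z hz).1
    unfold fracKernel
    gcongr
    exact (hball z hz).2

end Kernel

/-! ### The fractional Laplacian as a continuous function -/

section FracLaplacian

variable {N : ℕ} {σ : ℝ} {w : EuclideanSpace ℝ (Fin N) → ℝ} {c : ℝ}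

lemma ae_comp_add {p : EuclideanSpace ℝ (Fin N) → Prop} (h : ∀ᵐ y, p y)
    (x : EuclideanSpace ℝ (Fin N)) : ∀ᵐ z, p (x + z) :=
  (measurePreserving_add_left volume x).quasiMeasurePreserving.ae h

lemma ae_comp_neg {p : EuclideanSpace ℝ (Fin N) → Prop} (h : ∀ᵐ y, p y) : ∀ᵐ z, p (-z) :=
  (Measure.measurePreserving_neg volume).quasiMeasurePreserving.ae h

lemma ae_comp_add_and_neg {p : EuclideanSpace ℝ (Fin N) → Prop} (h : ∀ᵐ y, p y)
    (x : EuclideanSpace ℝ (Fin N)) : ∀ᵐ z, p (x + z) ∧ p (x + -z) :=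
  (ae_comp_add h x).and (ae_comp_neg (p := fun z => p (x + z)) (ae_comp_add h x))

lemma aestronglyMeasurable_comp_add (hw : AEStronglyMeasurable w volume)
    (x : EuclideanSpace ℝ (Fin N)) : AEStronglyMeasurable (fun z => w (x + z)) volume :=
  hw.comp_measurePreserving (measurePreserving_add_left volume x)

lemma aestronglyMeasurable_secondDiff (hw : AEStronglyMeasurable w volume)
    (x : EuclideanSpace ℝ (Fin N)) : AEStronglyMeasurable (secondDiff w x) volume := by
  have h1 := aestronglyMeasurable_comp_add hw x
  have h2 : AEStronglyMeasurable (fun z => w (x + -z)) volume :=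
    h1.comp_measurePreserving (Measure.measurePreserving_neg volume)
  exact (aestronglyMeasurable_const.sub h1).sub h2

/-- Symmetrization of an integral against an even integrable kernel. -/
lemma integral_sub_mul_even (hw : AEStronglyMeasurable w volume) (hc : ∀ᵐ y, |w y| ≤ c)
    {k : EuclideanSpace ℝ (Fin N) → ℝ} (hk : Integrable k) (hev : ∀ z, k (-z) = k z)
    (x : EuclideanSpace ℝ (Fin N)) :
    Integrable (fun z => w (x + z) * k z) ∧ Integrable (fun z => secondDiff w x z * k z) ∧
    ∫ z, secondDiff w x z * k z = 2 * ∫ z, (w x - w (x + z)) * k z := by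
  have h1 : Integrable (fun z => w (x + z) * k z) :=
    hk.bdd_mul (c := c) (aestronglyMeasurable_comp_add hw x) (ae_comp_add hc x)
  have h2 : Integrable (fun z => (w x - w (x + z)) * k z) := by
    simp_rw [sub_mul]
    exact (hk.const_mul _).sub h1
  have h3 : Integrable (fun z => (w x - w (x + -z)) * k z) := by
    have := h2.comp_neg
    simpa only [hev] using this
  have h4 : ∫ z, (w x - w (x + -z)) * k z = ∫ z, (w x - w (x + z)) * k z := by
    rw [← integral_neg_eq_self (fun z => (w x - w (x + z)) * k z)]
    simp only [hev]
  have h5 : (fun z => secondDiff w x z * k z) =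
      fun z => (w x - w (x + z)) * k z + (w x - w (x + -z)) * k z := by
    funext z
    unfold secondDiff
    ring
  refine ⟨h1, h5 ▸ h2.add h3, ?_⟩
  rw [h5, integral_add h2 h3, h4, two_mul]

/-- The first-order Taylor terms at `z` and `-z` cancel. Uniformity in `x` serves the domination in
`continuousAt_integral_secondDiff`. -/
lemma exists_secondDiff_bound {x₀ : EuclideanSpace ℝ (Fin N)} (hw : ContDiffAt ℝ 2 w x₀) :
    ∃ r > 0, r ≤ 1 ∧ ∃ L : ℝ, 0 ≤ L ∧ (∀ a ∈ Metric.ball x₀ (2 * r), ContinuousAt w a) ∧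
      ∀ x ∈ Metric.ball x₀ r, ∀ z, ‖z‖ < r → |secondDiff w x z| ≤ L * ‖z‖ ^ 2 := by
  obtain ⟨s, hs, L, hL, hd, h⟩ := taylor_bound hw
  have h2 : 2 * min (s / 2) 1 ≤ s := by linarith [min_le_left (s / 2) 1]
  refine ⟨min (s / 2) 1, by positivity, min_le_right _ _, 2 * L, by positivity,
    fun a ha => (hd a (Metric.ball_subset_ball h2 ha)).continuousAt, fun x hx z hz => ?_⟩
  have hx' : ‖x - x₀‖ < min (s / 2) 1 := by rwa [← dist_eq_norm]
  have hmem : ∀ v, ‖v‖ = ‖z‖ → x + v ∈ Metric.ball x₀ s := fun v hv => by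
    rw [mem_ball_iff_norm, add_sub_right_comm]
    have := norm_add_le (x - x₀) v
    linarith
  have hxs : x ∈ Metric.ball x₀ s := Metric.ball_subset_ball (by linarith) hx
  have h3 := h x hxs (x + z) (hmem z rfl)
  have h4 := h x hxs (x + -z) (hmem (-z) (norm_neg z))
  rw [add_sub_cancel_left] at h3 h4
  rw [norm_neg, map_neg] at h4
  unfold secondDiff
  rw [abs_le] at *
  constructor <;> linarith

lemma integrable_secondDiff_mul_fracKernel (hN : 1 ≤ N) (hσ₀ : 0 < σ) (hσ₁ : σ < 1)
    (hw : AEStronglyMeasurable w volume) (hc : ∀ᵐ y, |w y| ≤ c)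
    {x : EuclideanSpace ℝ (Fin N)} {r L : ℝ} (hr : 0 < r) (hr1 : r ≤ 1) (hL : 0 ≤ L)
    (h : ∀ z, ‖z‖ < r → |secondDiff w x z| ≤ L * ‖z‖ ^ 2) :
    Integrable (fun z => secondDiff w x z * fracKernel N σ z) := by
  have hc0 : 0 ≤ c := by
    obtain ⟨y, hy⟩ := hc.exists
    exact (abs_nonneg _).trans hy
  set C := L + (2 * |w x| + 2 * c) / r ^ 2
  refine ((integrable_min_mul_fracKernel hN hσ₀ hσ₁).const_mul C).mono'
    ((aestronglyMeasurable_secondDiff hw x).mul measurable_fracKernel.aestronglyMeasurable) ?_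
  filter_upwards [ae_comp_add_and_neg hc x] with z hz
  rw [Real.norm_eq_abs, abs_mul, abs_of_nonneg (fracKernel_nonneg z), ← mul_assoc]
  refine mul_le_mul_of_nonneg_right ?_ (fracKernel_nonneg z)
  have hA : 0 ≤ (2 * |w x| + 2 * c) / r ^ 2 := by positivity
  have hm : 0 ≤ min 1 (‖z‖ ^ 2) := by positivity
  rcases lt_or_ge ‖z‖ r with hzr | hzr
  · have h1 : min 1 (‖z‖ ^ 2) = ‖z‖ ^ 2 :=
      min_eq_right (pow_le_one₀ (norm_nonneg z) (hzr.le.trans hr1))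
    rw [h1] at hm ⊢
    rw [add_mul]
    linarith [h z hzr, mul_nonneg hA hm]
  · have h1 : r ^ 2 ≤ min 1 (‖z‖ ^ 2) :=
      le_min (pow_le_one₀ hr.le hr1) (pow_le_pow_left₀ hr.le hzr 2)
    have h2 : |secondDiff w x z| ≤ 2 * |w x| + 2 * c := by
      have h3 := abs_le.1 hz.1
      have h4 := abs_le.1 hz.2
      have h5 := neg_abs_le (w x)
      have h6 := le_abs_self (w x)
      rw [secondDiff, abs_le]
      constructor <;> linarith
    have h3 := mul_le_mul_of_nonneg_left h1 hA
    rw [div_mul_cancel₀ _ (by positivity)] at h3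
    rw [add_mul]
    linarith [mul_nonneg hL hm]

/-- For a bounded function that is `C²` near `x`, the principal value exists, and is given by the
integral of second differences. -/
lemma fracLaplacian_eq_integral (hN : 1 ≤ N) (hσ₀ : 0 < σ) (hσ₁ : σ < 1)
    (hw : AEStronglyMeasurable w volume) (hc : ∀ᵐ y, |w y| ≤ c)
    {x : EuclideanSpace ℝ (Fin N)} (hx : ContDiffAt ℝ 2 w x) :
    fracLaplacian σ w x =
      fracConst N σ * (2⁻¹ * ∫ z, secondDiff w x z * fracKernel N σ z) := by
  obtain ⟨r, hr, hr1, L, hL, -, hb⟩ := exists_secondDiff_bound hx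
  have hint := integrable_secondDiff_mul_fracKernel hN hσ₀ hσ₁ hw hc hr hr1 hL
    (hb x (Metric.mem_ball_self hr))
  have hmeas : ∀ ε : ℝ, MeasurableSet (Metric.ball (0 : EuclideanSpace ℝ (Fin N)) ε)ᶜ :=
    fun ε => measurableSet_ball.compl
  have key : ∀ ε : ℝ, 0 < ε →
      ∫ y in (Metric.ball x ε)ᶜ, (w x - w y) / ‖x - y‖ ^ ((N : ℝ) + 2 * σ) =
      2⁻¹ * ∫ z, (Metric.ball (0 : EuclideanSpace ℝ (Fin N)) ε)ᶜ.indicator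
        (fun z => secondDiff w x z * fracKernel N σ z) z := fun ε hε => by
    set k : EuclideanSpace ℝ (Fin N) → ℝ := (Metric.ball 0 ε)ᶜ.indicator (fracKernel N σ) with hk
    have hkint : Integrable k := by
      rw [hk, integrable_indicator_iff (hmeas ε)]
      refine (integrable_truncKernel hσ₀ hε).integrableOn.congr_fun (fun z hz => ?_) (hmeas ε)
      exact truncKernel_eq (by simpa using hz)
    have hkev : ∀ z, k (-z) = k z := fun z => by
      rw [hk]
      simp [indicator, fracKernel_neg]
    have h1 := (integral_sub_mul_even hw hc hkint hkev x).2.2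
    have h2 : ∀ f : EuclideanSpace ℝ (Fin N) → ℝ, (fun z => f z * k z) =
        (Metric.ball 0 ε)ᶜ.indicator (fun z => f z * fracKernel N σ z) := fun f => by
      funext z
      by_cases hz : z ∈ (Metric.ball (0 : EuclideanSpace ℝ (Fin N)) ε)ᶜ
      · simp only [hk, indicator_of_mem hz]
      · simp only [hk, indicator_of_notMem hz, mul_zero]
    rw [← h2, h1, inv_mul_cancel_left₀ two_ne_zero, ← integral_indicator measurableSet_ball.compl,
      ← integral_add_left_eq_self _ x]
    congr 1
    funext z
    by_cases hz : z ∈ (Metric.ball (0 : EuclideanSpace ℝ (Fin N)) ε)ᶜ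
    · have hz' : x + z ∈ (Metric.ball x ε)ᶜ := by simpa using hz
      simp only [hk, indicator_of_mem hz, indicator_of_mem hz']
      rw [fracKernel, div_eq_mul_inv, sub_add_cancel_left, norm_neg]
    · have hz' : x + z ∉ (Metric.ball x ε)ᶜ := by simpa using hz
      simp only [hk, indicator_of_notMem hz, indicator_of_notMem hz', mul_zero]
  have hlim : Tendsto (fun ε : ℝ => ∫ z, (Metric.ball (0 : EuclideanSpace ℝ (Fin N)) ε)ᶜ.indicator
        (fun z => secondDiff w x z * fracKernel N σ z) z) (𝓝[>] 0)
      (𝓝 (∫ z, secondDiff w x z * fracKernel N σ z)) := by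
    refine tendsto_integral_filter_of_dominated_convergence
      (fun z => ‖secondDiff w x z * fracKernel N σ z‖) ?_ ?_ hint.norm ?_
    · exact Eventually.of_forall fun ε => hint.aestronglyMeasurable.indicator (hmeas ε)
    · exact Eventually.of_forall fun ε => Eventually.of_forall fun z => norm_indicator_le_norm_self _ _
    · have h0 : ∀ᵐ z : EuclideanSpace ℝ (Fin N), z ≠ 0 := by
        have := nontrivial_euclidean hN
        exact Measure.ae_ne volume 0
      filter_upwards [h0] with z hz
      refine tendsto_const_nhds.congr' ?_
      filter_upwards [mem_nhdsWithin_of_mem_nhds (Iio_mem_nhds (norm_pos_iff.2 hz))] with ε hε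
      have : z ∈ (Metric.ball (0 : EuclideanSpace ℝ (Fin N)) ε)ᶜ := by
        have : ε < ‖z‖ := hε
        simpa using this.le
      rw [indicator_of_mem this]
  rw [fracLaplacian]
  congr 1
  refine Tendsto.limUnder_eq ((hlim.const_mul 2⁻¹).congr' ?_)
  filter_upwards [self_mem_nhdsWithin] with ε hε
  exact (key ε hε).symm

/-- Since `w` is only measurable, a translation moves `x` into the continuous kernel before
dominated convergence is applied. -/
lemma continuous_integral_mul_truncKernel (hσ : 0 < σ) (hw : AEStronglyMeasurable w volume)
    (hc : ∀ᵐ y, |w y| ≤ c) {r : ℝ} (hr : 0 < r) :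
    Continuous fun x => ∫ z, w (x + z) * truncKernel N σ r z := by
  have hc0 : 0 ≤ c := by
    obtain ⟨y, hy⟩ := hc.exists
    exact (abs_nonneg _).trans hy
  have h1 : (fun x => ∫ z, w (x + z) * truncKernel N σ r z) =
      fun x => ∫ y, w y * truncKernel N σ r (y - x) := by
    funext x
    have h := integral_add_left_eq_self (μ := volume)
      (fun y => w y * truncKernel N σ r (y - x)) x
    simpa only [add_sub_cancel_left] using h
  rw [h1, continuous_iff_continuousAt]
  intro x₀
  set a := (N : ℝ) + 2 * σ with ha
  have ha0 : 0 < a := by positivity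
  have hint : Integrable fun y : EuclideanSpace ℝ (Fin N) =>
      c * ((1 + 1 / r) ^ a * (2 ^ a * (1 + ‖y - x₀‖) ^ (-a))) := by
    have h := integrable_one_add_norm (E := EuclideanSpace ℝ (Fin N)) (μ := volume)
      (r := a) (by simpa [ha] using hσ)
    exact (((h.comp_sub_right x₀).const_mul _).const_mul _).const_mul _
  refine continuousAt_of_dominated ?_ ?_ hint ?_
  · exact Eventually.of_forall fun x => hw.mul
      ((continuous_truncKernel hr).comp (continuous_id.sub continuous_const)).aestronglyMeasurable
  · filter_upwards [Metric.ball_mem_nhds x₀ one_pos] with x hx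
    filter_upwards [hc] with y hy
    rw [norm_mul, Real.norm_of_nonneg (truncKernel_nonneg _), Real.norm_eq_abs]
    refine mul_le_mul hy ((truncKernel_le_one_add_norm hσ hr _).trans ?_) (truncKernel_nonneg _) hc0
    refine mul_le_mul_of_nonneg_left ?_ (by positivity)
    have h2 : 1 + ‖y - x₀‖ ≤ 2 * (1 + ‖y - x‖) := by
      have h3 := norm_add_le (y - x) (x - x₀)
      rw [sub_add_sub_cancel] at h3
      rw [mem_ball_iff_norm] at hx
      linarith [norm_nonneg (y - x)]
    have h4 : (0 : ℝ) < 1 + ‖y - x‖ := by positivity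
    have h5 : (0 : ℝ) < 1 + ‖y - x₀‖ := by positivity
    rw [← ha, Real.rpow_neg h4.le, Real.rpow_neg h5.le, ← div_eq_mul_inv, inv_eq_one_div,
      div_le_div_iff₀ (by positivity) (by positivity), one_mul, ← Real.mul_rpow (by norm_num) h4.le]
    exact Real.rpow_le_rpow h5.le h2 ha0.le
  · refine Eventually.of_forall fun y => ?_
    exact (continuous_const.mul ((continuous_truncKernel hr).comp
      (continuous_const.sub continuous_id))).continuousAt

/-- The kernel is split as (`fracKernel` - `truncKernel`) + `truncKernel`. The difference vanishes
for `‖z‖ ≥ r`, where continuity of `w` is unknown; the truncated kernel is integrable and even,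
leaving a convolution. -/
lemma continuousAt_integral_secondDiff (hN : 1 ≤ N) (hσ₀ : 0 < σ) (hσ₁ : σ < 1)
    (hw : AEStronglyMeasurable w volume) (hc : ∀ᵐ y, |w y| ≤ c)
    {x₀ : EuclideanSpace ℝ (Fin N)} (hx : ContDiffAt ℝ 2 w x₀) :
    ContinuousAt (fun x => ∫ z, secondDiff w x z * fracKernel N σ z) x₀ := by
  obtain ⟨r, hr, hr1, L, hL, hcont, hb⟩ := exists_secondDiff_bound hx
  have hwx : ContinuousAt w x₀ := hx.continuousAt
  have htr := fun x => integral_sub_mul_even hw hc (integrable_truncKernel hσ₀ hr)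
    (truncKernel_neg (N := N) (σ := σ)) x
  have hsplit : ∀ᶠ x in 𝓝 x₀, (∫ z, secondDiff w x z * (fracKernel N σ z - truncKernel N σ r z)) +
      2 * (w x * (∫ z, truncKernel N σ r z) - ∫ z, w (x + z) * truncKernel N σ r z) =
      ∫ z, secondDiff w x z * fracKernel N σ z := by
    filter_upwards [Metric.ball_mem_nhds x₀ hr] with x hxr
    have h1 := integrable_secondDiff_mul_fracKernel hN hσ₀ hσ₁ hw hc hr hr1 hL (hb x hxr)
    have h2 := (htr x).2.2
    simp_rw [sub_mul] at h2
    rw [integral_sub ((integrable_truncKernel hσ₀ hr).const_mul _) (htr x).1,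
      integral_const_mul] at h2
    rw [← h2]
    have h3 : (fun z => secondDiff w x z * (fracKernel N σ z - truncKernel N σ r z)) =
        fun z => secondDiff w x z * fracKernel N σ z - secondDiff w x z * truncKernel N σ r z :=
      funext fun z => mul_sub _ _ _
    rw [h3, integral_sub h1 (htr x).2.1, sub_add_cancel]
  refine ContinuousAt.congr ?_ hsplit
  refine ContinuousAt.add ?_ (continuousAt_const.mul ((hwx.mul continuousAt_const).sub
    (continuous_integral_mul_truncKernel hσ₀ hw hc hr).continuousAt))
  refine continuousAt_of_dominated (bound := fun z => L * (min 1 (‖z‖ ^ 2) * fracKernel N σ z))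
    ?_ ?_ ((integrable_min_mul_fracKernel hN hσ₀ hσ₁).const_mul L) ?_
  · exact Eventually.of_forall fun x => (aestronglyMeasurable_secondDiff hw x).mul
      (measurable_fracKernel.aestronglyMeasurable.sub
        (continuous_truncKernel hr).aestronglyMeasurable)
  · filter_upwards [Metric.ball_mem_nhds x₀ hr] with x hxr
    have h0 : ∀ᵐ z : EuclideanSpace ℝ (Fin N), z ≠ 0 := by
      have := nontrivial_euclidean hN
      exact Measure.ae_ne volume 0
    filter_upwards [h0] with z hz
    have hbd : 0 ≤ L * (min 1 (‖z‖ ^ 2) * fracKernel N σ z) :=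
      mul_nonneg hL (mul_nonneg (by positivity) (fracKernel_nonneg z))
    rcases lt_or_ge ‖z‖ r with hzr | hzr
    · have h1 : min 1 (‖z‖ ^ 2) = ‖z‖ ^ 2 :=
        min_eq_right (pow_le_one₀ (norm_nonneg z) (hzr.le.trans hr1))
      have h2 := truncKernel_le (N := N) hσ₀ (r := r) hz
      rw [norm_mul, Real.norm_eq_abs, Real.norm_of_nonneg (sub_nonneg.2 h2), h1, ← mul_assoc]
      refine mul_le_mul (hb x hxr z hzr) ?_ (sub_nonneg.2 h2) (by positivity)
      linarith [truncKernel_nonneg (N := N) (σ := σ) (r := r) z]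
    · rw [truncKernel_eq hzr, sub_self, mul_zero, norm_zero]
      exact hbd
  · refine Eventually.of_forall fun z => ?_
    rcases lt_or_ge ‖z‖ r with hzr | hzr
    · have h1 : ∀ v, ‖v‖ = ‖z‖ → ContinuousAt (fun x => w (x + v)) x₀ := fun v hv => by
        have h2 : ContinuousAt w (x₀ + v) := hcont _ (by
          rw [mem_ball_iff_norm, add_sub_cancel_left, hv]
          linarith)
        exact ContinuousAt.comp (f := fun x => x + v) h2 (by fun_prop)
      unfold secondDiff
      exact (((continuousAt_const.mul hwx).sub (h1 z rfl)).sub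
        (h1 (-z) (norm_neg z))).mul continuousAt_const
    · rw [truncKernel_eq hzr, sub_self]
      simp only [mul_zero]
      exact continuousAt_const

lemma continuousAt_fracLaplacian (hN : 1 ≤ N) (hσ₀ : 0 < σ) (hσ₁ : σ < 1)
    (hw : AEStronglyMeasurable w volume) (hc : ∀ᵐ y, |w y| ≤ c)
    {x₀ : EuclideanSpace ℝ (Fin N)} (hx : ContDiffAt ℝ 2 w x₀) :
    ContinuousAt (fracLaplacian σ w) x₀ := by
  have h := continuousAt_integral_secondDiff hN hσ₀ hσ₁ hw hc hx
  refine (continuousAt_const.mul (continuousAt_const.mul h) :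
    ContinuousAt (fun x => fracConst N σ * (2⁻¹ * ∫ z, secondDiff w x z * fracKernel N σ z))
      x₀).congr ?_
  filter_upwards [hx.eventually (by simp)] with x hx
  exact (fracLaplacian_eq_integral hN hσ₀ hσ₁ hw hc hx).symm

end FracLaplacian

/-! ### Both operators at a touching point -/

section Touching

variable {N : ℕ}

lemma norm_le_of_inner_eq_zero {E : Type*} [NormedAddCommGroup E] [InnerProductSpace ℝ E]
    {a v : E} (ha : a ≠ 0) (h : ⟪a, v⟫_ℝ = 0) : ‖a + v‖ ≤ ‖a‖ + ‖v‖ ^ 2 / (2 * ‖a‖) := by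
  have ha' : 0 < ‖a‖ := norm_pos_iff.2 ha
  have h1 : ‖a + v‖ ^ 2 = ‖a‖ ^ 2 + ‖v‖ ^ 2 := by
    rw [norm_add_sq_real, h]; ring
  have h2 : 0 ≤ ‖v‖ ^ 2 / (2 * ‖a‖) := by positivity
  refine le_of_sq_le_sq ?_ (by positivity)
  rw [h1, add_sq]
  have h3 : 2 * ‖a‖ * (‖v‖ ^ 2 / (2 * ‖a‖)) = ‖v‖ ^ 2 := by field_simp
  nlinarith [sq_nonneg (‖v‖ ^ 2 / (2 * ‖a‖))]

/-- The parallelogram law combined with `2 t ‖a‖ ≤ t² + ‖a‖²` for `t = ‖a ± v‖`. -/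
lemma norm_add_add_norm_sub_le {E : Type*} [NormedAddCommGroup E] [InnerProductSpace ℝ E]
    {a v : E} (ha : a ≠ 0) : ‖a + v‖ + ‖a - v‖ ≤ 2 * ‖a‖ + ‖v‖ ^ 2 / ‖a‖ := by
  have ha' : 0 < ‖a‖ := norm_pos_iff.2 ha
  have h1 := parallelogram_law_with_norm ℝ a v
  have h2 : 2 * ‖a‖ + ‖v‖ ^ 2 / ‖a‖ = (2 * ‖a‖ * ‖a‖ + ‖v‖ ^ 2) / ‖a‖ := by field_simp
  rw [h2, le_div_iff₀ ha']
  nlinarith [sq_nonneg (‖a + v‖ - ‖a‖), sq_nonneg (‖a - v‖ - ‖a‖)]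

/-- Upper bound for the Laplacian of a function touched from above by a radial profile. -/
lemma laplacian_le_of_touching_profile (hN : 1 ≤ N) {w : EuclideanSpace ℝ (Fin N) → ℝ}
    {x q : EuclideanSpace ℝ (Fin N)} {κ α ρ d B : ℝ} (hw : ContDiffAt ℝ 2 w x) (hα : 0 < α)
    (hα1 : α < 1) (hρ : 0 < ρ) (hκ : κ = N / ρ) (hd : 0 < d) (hB : 0 ≤ B) (hxq : ‖x - q‖ = d + ρ)
    (h : ∀ᶠ y in 𝓝 x, w y - w x ≤ B * (profile κ α (‖y - q‖ - ρ) - profile κ α d)) :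
    Laplacian.laplacian w x ≤ B * (profileDeriv2 κ α d + κ * profileDeriv κ α d) := by
  have hκ0 : 0 < κ := by
    have : (0 : ℝ) < N := by exact_mod_cast hN
    rw [hκ]; positivity
  have hR : 0 < d + ρ := by linarith
  have hxq0 : x - q ≠ 0 := norm_pos_iff.1 (hxq ▸ hR)
  set i₀ : Fin N := ⟨0, hN⟩
  set e : EuclideanSpace ℝ (Fin N) := (d + ρ)⁻¹ • (x - q) with he
  have he1 : ‖e‖ = 1 := by
    rw [he, norm_smul, hxq, norm_inv, Real.norm_of_nonneg hR.le, inv_mul_cancel₀ hR.ne']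
  have hxe : x - q = (d + ρ) • e := by rw [he, smul_inv_smul₀ hR.ne']
  obtain ⟨b, hb⟩ := Orthonormal.exists_orthonormalBasis_extension_of_card_eq (𝕜 := ℝ)
    (E := EuclideanSpace ℝ (Fin N)) (ι := Fin N) (by simp) (v := fun _ => e) (s := {i₀}) (by
      rw [orthonormal_iff_ite]
      intro i j
      rw [if_pos (Subsingleton.elim i j)]
      simp [he1])
  have hb0 : b i₀ = e := hb i₀ rfl
  have hline := fun v : EuclideanSpace ℝ (Fin N) => (tendsto_line x v).eventually h
  -- The `N - 1` tangential directions each cost `B ψ' / ρ`. The radial one is granted the same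
  -- nonnegative term, so that the sum is exactly `κ B ψ'`.
  have hterm : ∀ i, iteratedFDeriv ℝ 2 w x ![b i, b i] ≤
      (if i = i₀ then B * profileDeriv2 κ α d else 0) + B * profileDeriv κ α d / ρ := by
    intro i
    have hBD : 0 ≤ B * profileDeriv κ α d / ρ :=
      div_nonneg (mul_nonneg hB (profileDeriv_nonneg hκ0 hα hd)) hρ.le
    by_cases hi : i = i₀
    · rw [if_pos hi, hi, hb0]
      have hnear : ∀ᶠ s in 𝓝 (0 : ℝ), -d < s := lt_mem_nhds (by linarith)
      have hshift : ∀ s : ℝ, HasDerivAt (fun t => d + t) 1 s := fun s =>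
        (hasDerivAt_id s).const_add d
      refine le_trans (iteratedFDeriv_two_le_of_touching hw (q := fun s => B * profile κ α (d + s))
        (q' := fun s => B * profileDeriv κ α (d + s)) (b := B * profileDeriv2 κ α d) ?_ ?_ ?_)
        (le_add_of_nonneg_right hBD)
      · filter_upwards [hnear] with s hs
        have := (hasDerivAt_profile (α := α) hκ0 (t := d + s) (by linarith)).comp s (hshift s)
        simpa using this.const_mul B
      · have h1 : HasDerivAt (profileDeriv κ α) (profileDeriv2 κ α d) (d + 0) := by
          rw [add_zero]
          exact hasDerivAt_profileDeriv hκ0 hd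
        simpa using (h1.comp 0 (hshift 0)).const_mul B
      · filter_upwards [hline e, hnear] with s hs hs1
        have h1 : ‖x + s • e - q‖ - ρ = d + s := by
          rw [add_sub_right_comm, hxe, ← add_smul, norm_smul, he1, mul_one,
            Real.norm_of_nonneg (by linarith)]
          ring
        rw [h1] at hs
        simpa [mul_sub] using hs
    · rw [if_neg hi, zero_add]
      have hbi : ‖b i‖ = 1 := b.orthonormal.1 i
      have hperp : ⟪x - q, b i⟫_ℝ = 0 := by
        rw [hxe, inner_smul_left, ← hb0, b.orthonormal.2 (Ne.symm hi), mul_zero]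
      refine iteratedFDeriv_two_le_of_touching hw
        (q := fun s => B * profileDeriv κ α d / ρ / 2 * s ^ 2)
        (q' := fun s => B * profileDeriv κ α d / ρ * s) ?_ ?_ ?_
      · refine Eventually.of_forall fun s => ?_
        refine ((hasDerivAt_pow 2 s).const_mul (B * profileDeriv κ α d / ρ / 2)).congr_deriv ?_
        norm_num
        ring
      · simpa using (hasDerivAt_id (0 : ℝ)).const_mul (B * profileDeriv κ α d / ρ)
      · have hpos : ∀ᶠ s in 𝓝 (0 : ℝ), ρ < ‖x + s • b i - q‖ := by
          have h1 : Tendsto (fun s : ℝ => ‖x + s • b i - q‖) (𝓝 0) (𝓝 ‖x - q‖) :=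
            ((tendsto_line x (b i)).sub_const q).norm
          exact h1.eventually_const_lt (by rw [hxq]; linarith)
        filter_upwards [hline (b i), hpos] with s hs hs1
        refine hs.trans ?_
        have h1 : ‖x + s • b i - q‖ ≤ d + ρ + s ^ 2 / (2 * ρ) := by
          rw [add_sub_right_comm]
          refine (norm_le_of_inner_eq_zero hxq0 (by rw [inner_smul_right, hperp, mul_zero])).trans ?_
          rw [hxq, norm_smul, hbi, mul_one, Real.norm_eq_abs, sq_abs]
          gcongr
          linarith
        have h2 := profile_le_tangent hκ0 hα hα1 (s := ‖x + s • b i - q‖ - ρ) (by linarith) hd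
        have h3 := profileDeriv_nonneg hκ0 hα hd
        have h4 : profile κ α (‖x + s • b i - q‖ - ρ) - profile κ α d ≤
            profileDeriv κ α d * (s ^ 2 / (2 * ρ)) := by
          have := mul_le_mul_of_nonneg_left
            (show ‖x + s • b i - q‖ - ρ - d ≤ s ^ 2 / (2 * ρ) by linarith) h3
          linarith
        refine (mul_le_mul_of_nonneg_left h4 hB).trans_eq ?_
        field_simp
        ring
  rw [InnerProductSpace.laplacian_eq_iteratedFDeriv_orthonormalBasis w b]
  refine (Finset.sum_le_sum fun i _ => hterm i).trans_eq ?_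
  rw [Finset.sum_add_distrib, Finset.sum_ite_eq' Finset.univ i₀, if_pos (Finset.mem_univ _),
    Finset.sum_const, Finset.card_univ, Fintype.card_fin, nsmul_eq_mul, hκ]
  field_simp

lemma fracConst_pos {σ : ℝ} (hσ₀ : 0 < σ) (hσ₁ : σ < 1) : 0 < fracConst N σ := by
  have h1 : 0 < Real.Gamma (N / 2 + σ) := Real.Gamma_pos_of_pos (by positivity)
  have h2 : 0 < Real.Gamma (1 - σ) := Real.Gamma_pos_of_pos (by linarith)
  have := Real.pi_pos
  unfold fracConst
  positivity

/-- A function whose second differences are controlled near `x`, which does not exceed its value at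
`x` by much elsewhere and drops a lot on a ball at distance comparable to `d`, has positive
fractional Laplacian at `x`. -/
lemma fracLaplacian_pos {σ : ℝ} (hN : 1 ≤ N) (hσ₀ : 0 < σ) (hσ₁ : σ < 1)
    {w : EuclideanSpace ℝ (Fin N) → ℝ} {c : ℝ} (hw : AEStronglyMeasurable w volume)
    (hc : ∀ᵐ y, |w y| ≤ c) {x e : EuclideanSpace ℝ (Fin N)} (hx : ContDiffAt ℝ 2 w x)
    {d θ A B K : ℝ} (hd : 0 < d) (hθ : 0 < θ) (hA : 2 ≤ A) (hB : 0 < B) (hK0 : 0 ≤ K)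
    (hball : ∀ z ∈ Metric.ball e (θ * d), d ≤ ‖z‖ ∧ ‖z‖ ≤ 3 * d)
    (hnear : ∀ z, ‖z‖ < d → -(B * A) * (‖z‖ ^ 2 / d ^ 2) ≤ secondDiff w x z)
    (hfar : ∀ᵐ z, d ≤ ‖z‖ → -B ≤ w x - w (x + z))
    (hdrop : ∀ᵐ z, z ∈ Metric.ball e (θ * d) → B * K ≤ w x - w (x + z))
    (hK : A * ∫ z : EuclideanSpace ℝ (Fin N), min 1 (‖z‖ ^ 2) * fracKernel N σ z <
      K * (volume.real (Metric.ball (0 : EuclideanSpace ℝ (Fin N)) 1) * θ ^ N *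
        ((3 : ℝ) ^ ((N : ℝ) + 2 * σ))⁻¹)) :
    0 < fracLaplacian σ w x := by
  rw [fracLaplacian_eq_integral hN hσ₀ hσ₁ hw hc hx]
  refine mul_pos (fracConst_pos hσ₀ hσ₁) (mul_pos (by norm_num) ?_)
  obtain ⟨r, hr, hr1, L, hL, -, hb⟩ := exists_secondDiff_bound hx
  have hint := integrable_secondDiff_mul_fracKernel hN hσ₀ hσ₁ hw hc hr hr1 hL
    (hb x (Metric.mem_ball_self hr))
  have hmin := integrable_scaled_min_mul_fracKernel (N := N) hN hσ₀ hσ₁ hd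
  obtain ⟨hbi, hbge⟩ := fracKernel_integral_ball_ge hN hσ₀ hd hθ hball
  have hind : Integrable ((Metric.ball e (θ * d)).indicator (fracKernel N σ)) :=
    (integrable_indicator_iff measurableSet_ball).2 hbi
  -- Beyond distance `d` each one-sided difference is at least `-B`, and `2 ≤ A` absorbs both. On
  -- the ball one of them is at least `B K`.
  have hlow : ∀ᵐ z : EuclideanSpace ℝ (Fin N),
      -(B * A) * (min 1 (‖z‖ ^ 2 / d ^ 2) * fracKernel N σ z) +
        B * K * (Metric.ball e (θ * d)).indicator (fracKernel N σ) z ≤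
      secondDiff w x z * fracKernel N σ z := by
    filter_upwards [hfar, ae_comp_neg hfar, hdrop] with z h1 h2 h3
    have hk := fracKernel_nonneg (σ := σ) z
    rw [norm_neg] at h2
    rcases lt_or_ge ‖z‖ d with hzd | hzd
    · have hz : z ∉ Metric.ball e (θ * d) := fun hz => absurd (hball z hz).1 (not_le.2 hzd)
      rw [indicator_of_notMem hz, mul_zero, add_zero, min_eq_right, ← mul_assoc]
      · exact mul_le_mul_of_nonneg_right (hnear z hzd) hk
      · rw [div_le_one (by positivity)]
        exact pow_le_pow_left₀ (norm_nonneg z) hzd.le 2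
    · have hm : min 1 (‖z‖ ^ 2 / d ^ 2) = 1 := by
        refine min_eq_left ?_
        rw [one_le_div (by positivity)]
        exact pow_le_pow_left₀ hd.le hzd 2
      rw [hm, one_mul]
      have h4 := h1 hzd
      have h5 := h2 hzd
      have hBA : B * 2 ≤ B * A := mul_le_mul_of_nonneg_left hA hB.le
      by_cases hz : z ∈ Metric.ball e (θ * d)
      · rw [indicator_of_mem hz, ← add_mul]
        refine mul_le_mul_of_nonneg_right ?_ hk
        have h6 := h3 hz
        unfold secondDiff
        linarith
      · rw [indicator_of_notMem hz, mul_zero, add_zero]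
        refine mul_le_mul_of_nonneg_right ?_ hk
        unfold secondDiff
        linarith
  have hmono := integral_mono_ae ((hmin.const_mul (-(B * A))).add (hind.const_mul (B * K))) hint hlow
  refine lt_of_lt_of_le ?_ hmono
  have hsum := integral_add (hmin.const_mul (-(B * A))) (hind.const_mul (B * K))
  simp only [Pi.add_apply]
  rw [hsum, integral_const_mul, integral_const_mul, integral_indicator measurableSet_ball,
    integral_scaled_min_mul_fracKernel hd]
  have hd' : 0 < d ^ (-(2 * σ)) := Real.rpow_pos_of_pos hd _
  have h1 := mul_le_mul_of_nonneg_left hbge (mul_nonneg hB.le hK0)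
  have h2 := mul_lt_mul_of_pos_left hK (mul_pos hB hd')
  linarith

lemma continuousAt_laplacian {w : EuclideanSpace ℝ (Fin N) → ℝ} {x : EuclideanSpace ℝ (Fin N)}
    (hw : ContDiffAt ℝ 2 w x) : ContinuousAt (Laplacian.laplacian w) x := by
  rw [InnerProductSpace.laplacian_eq_iteratedFDeriv_stdOrthonormalBasis]
  have h : ContinuousAt (iteratedFDeriv ℝ 2 w) x :=
    (hw.iteratedFDeriv_right (i := 2) (m := 0) (by norm_num)).continuousAt
  refine tendsto_finsetSum _ fun i _ => ?_
  exact ((ContinuousMultilinearMap.apply ℝ _ ℝ _).continuous.continuousAt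
    (x := iteratedFDeriv ℝ 2 w x)).comp h

/-- An implication `0 ≤ a → b ≤ 0` that holds almost everywhere passes to points of continuity
where `a` is positive. -/
lemma nonpos_of_ae_imp {X : Type*} [TopologicalSpace X] [MeasurableSpace X] {μ : Measure X}
    [μ.IsOpenPosMeasure] {Ω : Set X} (hΩ : IsOpen Ω) (hΩm : MeasurableSet Ω) {x : X} (hx : x ∈ Ω)
    {a b : X → ℝ} (ha : ContinuousAt a x) (hb : ContinuousAt b x)
    (h : ∀ᵐ y ∂(μ.restrict Ω), 0 ≤ a y → b y ≤ 0) (hax : 0 < a x) : b x ≤ 0 := by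
  by_contra! hbx
  rw [ae_restrict_iff' hΩm] at h
  have h1 : {y | y ∈ Ω ∧ 0 < a y ∧ 0 < b y} ∈ 𝓝 x := by
    filter_upwards [hΩ.mem_nhds hx, ha.eventually_const_lt hax, hb.eventually_const_lt hbx]
      with y h1 h2 h3
    exact ⟨h1, h2, h3⟩
  refine (Measure.measure_pos_of_mem_nhds μ h1).ne' (measure_mono_null ?_ (ae_iff.1 h))
  rintro y ⟨hy, hay, hby⟩ hcon
  exact absurd (hcon hy hay.le) (not_le.2 hby)

end Touching

/-! ### Ingredients at the maximum point -/

section Comparison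

variable {N : ℕ}

lemma ball_distCompl_subset {Ω : Set (EuclideanSpace ℝ (Fin N))} (x : EuclideanSpace ℝ (Fin N)) :
    Metric.ball x (distCompl Ω x) ⊆ Ω := fun y hy => by
  by_contra hyΩ
  have h := Metric.infDist_le_dist_of_mem (x := x) (show y ∈ Ωᶜ from hyΩ)
  rw [Metric.mem_ball, dist_comm] at hy
  exact absurd hy (not_lt.2 h)

/-- Lower bound for second differences of a function touched from above by a radial profile. -/
lemma secondDiff_ge_of_touching_profile {w : EuclideanSpace ℝ (Fin N) → ℝ}
    {x q : EuclideanSpace ℝ (Fin N)} {κ α ρ d B D : ℝ} (hα : 0 < α) (hα1 : α < 1) (hρ : 0 < ρ)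
    (hκ : 0 < κ) (hd : 0 < d) (hdD : d ≤ D) (hB : 0 ≤ B) (hxq : ‖x - q‖ = d + ρ)
    (h : ∀ y ∈ Metric.ball x d, ρ ≤ ‖y - q‖ ∧
      w y - w x ≤ B * (profile κ α (‖y - q‖ - ρ) - profile κ α d))
    {z : EuclideanSpace ℝ (Fin N)} (hz : ‖z‖ < d) :
    -(B * (2 + D / ρ)) * (‖z‖ ^ 2 / d ^ 2) ≤ secondDiff w x z := by
  have hxq0 : x - q ≠ 0 := norm_pos_iff.1 (by rw [hxq]; linarith)
  have hG := profileDeriv_nonneg hκ hα hd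
  have hone : ∀ v : EuclideanSpace ℝ (Fin N), ‖v‖ = ‖z‖ →
      w (x + v) - w x ≤ B * (profileDeriv κ α d * (‖x - q + v‖ - ρ - d)) := fun v hv => by
    obtain ⟨h1, h2⟩ := h (x + v) (by rwa [mem_ball_iff_norm, add_sub_cancel_left, hv])
    rw [add_sub_right_comm] at h1 h2
    refine h2.trans (mul_le_mul_of_nonneg_left ?_ hB)
    linarith [profile_le_tangent hκ hα hα1 (s := ‖x - q + v‖ - ρ) (by linarith) hd]
  have h1 := hone z rfl
  have h2 := hone (-z) (norm_neg z)
  have h3 := norm_add_add_norm_sub_le (v := z) hxq0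
  rw [sub_eq_add_neg _ z, hxq] at h3
  have h4 : ‖z‖ ^ 2 / (d + ρ) ≤ ‖z‖ ^ 2 / ρ := by gcongr; linarith
  -- From `ψ'(d) ≤ 1/d ≤ D/d²`; this is the share `D / ρ` of the constant `A`.
  have h5 : profileDeriv κ α d * (‖z‖ ^ 2 / ρ) ≤ D / ρ * (‖z‖ ^ 2 / d ^ 2) := by
    have h6 : profileDeriv κ α d ≤ D / d ^ 2 := by
      rw [le_div_iff₀ (by positivity)]
      nlinarith [profileDeriv_mul_le_one hκ hα hα1 hd]
    calc profileDeriv κ α d * (‖z‖ ^ 2 / ρ) ≤ D / d ^ 2 * (‖z‖ ^ 2 / ρ) := by gcongr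
      _ = _ := by field_simp
  have h7 := mul_le_mul_of_nonneg_left
    (show ‖x - q + z‖ - ρ - d + (‖x - q + -z‖ - ρ - d) ≤ ‖z‖ ^ 2 / ρ by linarith)
    (mul_nonneg hB hG)
  have h8 := mul_le_mul_of_nonneg_left h5 hB
  have h9 : 0 ≤ B * (‖z‖ ^ 2 / d ^ 2) := by positivity
  unfold secondDiff
  linarith

lemma exists_ball_in_exterior {x p q : EuclideanSpace ℝ (Fin N)} {d ρ D : ℝ} (hd : 0 < d)
    (hdD : d ≤ D) (hρ : 0 < ρ) (hρ1 : ρ ≤ 1) (hD : 1 ≤ D) (hxp : ‖x - p‖ = d)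
    (hpq : ‖p - q‖ = ρ) (hxq : ‖x - q‖ = d + ρ) :
    ∃ e : EuclideanSpace ℝ (Fin N), ∀ z ∈ Metric.ball e (ρ / D * d),
      (d ≤ ‖z‖ ∧ ‖z‖ ≤ 3 * d) ∧ ‖x + z - q‖ < ρ := by
  have hD0 : 0 < D := by linarith
  set r := ρ / D * d with hr
  have hr0 : 0 < r := by positivity
  have hrd : r ≤ d := by
    have : ρ / D ≤ 1 := (div_le_one hD0).2 (by linarith)
    nlinarith
  have hrρ : r ≤ ρ := by
    rw [hr, div_mul_eq_mul_div, div_le_iff₀ hD0]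
    gcongr
  -- Translated by `x`, the ball of radius `r` about this point is internally tangent to the
  -- exterior ball at `p`. Hence `‖z‖ ≥ (d + ρ) - ρ` and `‖z‖ ≤ r + r + d ≤ 3d`.
  refine ⟨p + (r / ρ) • (q - p) - x, fun z hz => ?_⟩
  rw [mem_ball_iff_norm] at hz
  have hqp : ‖q - p‖ = ρ := by rw [norm_sub_rev, hpq]
  have h1 : ‖x + z - q‖ < ρ := by
    have h2 : x + z - q = z - (p + (r / ρ) • (q - p) - x) + (1 - r / ρ) • (p - q) := by
      module
    have h3 : 0 ≤ 1 - r / ρ := by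
      rw [sub_nonneg, div_le_one hρ]
      exact hrρ
    rw [h2]
    refine (norm_add_le _ _).trans_lt ?_
    rw [norm_smul, hpq, Real.norm_of_nonneg h3, sub_mul, div_mul_cancel₀ _ hρ.ne']
    linarith
  refine ⟨⟨?_, ?_⟩, h1⟩
  · have h2 := norm_sub_le (x + z - q) z
    rw [show x + z - q - z = x - q by abel, hxq] at h2
    linarith
  · have h2 : z = z - (p + (r / ρ) • (q - p) - x) + ((r / ρ) • (q - p) - (x - p)) := by abel
    rw [h2]
    refine (norm_add_le _ _).trans ?_
    have h3 := norm_sub_le ((r / ρ) • (q - p)) (x - p)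
    rw [norm_smul, hqp, hxp, Real.norm_of_nonneg (by positivity), div_mul_cancel₀ _ hρ.ne'] at h3
    linarith

lemma ae_le_rpow_of_interior {Ω : Set (EuclideanSpace ℝ (Fin N))} (hN : 1 ≤ N)
    (hΩ : IsOpen Ω) (hb : Bornology.IsBounded Ω) {α : ℝ} {f : EuclideanSpace ℝ (Fin N) → ℝ}
    (hf : MemLp (fun x => distCompl Ω x ^ (2 - α) * f x) ∞ (volume.restrict Ω)) :
    ∀ᵐ x ∂(volume.restrict Ω), f x ≤
      essSup (fun y => distCompl Ω y ^ (2 - α) * max (f y) 0) (volume.restrict Ω) *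
        distCompl Ω x ^ (α - 2) := by
  have h : (fun y => distCompl Ω y ^ (2 - α) * max (f y) 0) =
      fun y => max (distCompl Ω y ^ (2 - α) * f y) 0 := by
    funext y
    rw [mul_max_of_nonneg _ _ (Real.rpow_nonneg (distCompl_nonneg Ω y) _), mul_zero]
  rw [h]
  filter_upwards [ae_max_zero_le_essSup hf, ae_restrict_mem hΩ.measurableSet] with x hx hxΩ
  have hd := distCompl_pos hN hΩ hb hxΩ
  rw [show α - 2 = -(2 - α) by ring, Real.rpow_neg hd.le, ← div_eq_mul_inv,
    le_div_iff₀ (Real.rpow_pos_of_pos hd _), mul_comm]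
  exact hx

end Comparison

/-! ### The comparison argument -/

theorem corollary3p2 {N : ℕ} (hN : 1 ≤ N) (σ : ℝ) (hσ₀ : 0 < σ) (hσ₁ : σ < 1)
    (Ω : Set (EuclideanSpace ℝ (Fin N))) (hΩ_open : IsOpen Ω)
    (hΩ_bdd : Bornology.IsBounded Ω) (hΩ_C2 : HasC2Boundary Ω)
    (αbar : ℝ) (hαbar : αbar < 1) :
    ∃ C : ℝ, 0 < C ∧
      ∀ (α : ℝ), 0 < α → α ≤ αbar →
      ∀ (Φ : EuclideanSpace ℝ (Fin N) → ℝ → ℝ), IsCaratheodory Ω Φ →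
        (∀ᵐ x ∂(volume.restrict Ω), Monotone (Φ x) ∧ 0 ≤ Φ x 0) →
      ∀ (f g h w : EuclideanSpace ℝ (Fin N) → ℝ),
        MemLp (fun x => distCompl Ω x ^ (2 - α) * f x) ∞ (volume.restrict Ω) →
        MemLp g ∞ (bdryMeasure Ω) →
        MemLp h ∞ (volume.restrict (closure Ω)ᶜ) →
        MemLp w ∞ volume → ContDiffOn ℝ 2 w Ω → ContinuousOn w (closure Ω) →
        IsSubsolution σ Ω Φ f g h w →
        ∀ x ∈ Ω, w x ≤
          essSup (fun y => max (g y) 0) (bdryMeasure Ω)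
            + essSup (fun y => max (h y) 0) (volume.restrict (closure Ω)ᶜ)
            + C * α⁻¹ *
              essSup (fun y => distCompl Ω y ^ (2 - α) * max (f y) 0) (volume.restrict Ω) := by
  have hnt := nontrivial_euclidean hN
  obtain ⟨ρ, hρ, hρ1, hext⟩ := exists_exterior_balls hN hΩ_open hΩ_bdd hΩ_C2
  obtain ⟨D, hD1, hD⟩ := exists_distCompl_le hΩ_bdd
  have hD0 : 0 < D := by linarith
  set κ : ℝ := N / ρ with hκ
  have hκ1 : 1 ≤ κ := by
    have : (1 : ℝ) ≤ N := by exact_mod_cast hN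
    rw [hκ, one_le_div hρ]
    linarith
  have hκ0 : 0 < κ := by linarith
  set A : ℝ := 2 + D / ρ with hA
  have hA2 : 2 ≤ A := by
    have : 0 ≤ D / ρ := by positivity
    linarith
  set θ : ℝ := ρ / D with hθ
  have hθ0 : 0 < θ := by positivity
  set J := ∫ z : EuclideanSpace ℝ (Fin N), min 1 (‖z‖ ^ 2) * fracKernel N σ z with hJ
  have hJ0 : 0 ≤ J := integral_nonneg fun z => mul_nonneg (by positivity) (fracKernel_nonneg z)
  set V := volume.real (Metric.ball (0 : EuclideanSpace ℝ (Fin N)) 1) * θ ^ N *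
        ((3 : ℝ) ^ ((N : ℝ) + 2 * σ))⁻¹ with hV
  have hV0 : 0 < V := by
    have : 0 < volume.real (Metric.ball (0 : EuclideanSpace ℝ (Fin N)) 1) :=
      ENNReal.toReal_pos (Metric.measure_ball_pos volume _ one_pos).ne' measure_ball_lt_top.ne
    positivity
  -- `A J` bounds the possible negative part and `V` the gain per unit of jump, both after removing
  -- the factor `B d^(-2σ)`.
  set K := A * J / V + 1 with hK
  have hK0 : 0 < K := by positivity
  have hKV : A * J < K * V := by
    have h1 : K * V = A * J + V := by
      rw [hK, add_one_mul, div_mul_cancel₀ _ hV0.ne']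
    rw [h1]
    exact lt_add_of_pos_right _ hV0
  have hαbar' : 0 < 1 - αbar := by linarith
  -- Offsets the factor `(1 - α) e^(-2κD)` of `profileDeriv2_add_le`; `αbar` enters only through `1
  -- - α ≥ 1 - αbar`.
  set C' := Real.exp (2 * κ * D) / (1 - αbar) with hC'
  have hC'0 : 0 < C' := by positivity
  refine ⟨C' * (K + 1), by positivity, ?_⟩
  intro α hα hααbar Φ _ hΦ f g h w hf hg hh hw hwC2 hwcont hsub x hx
  have hα1 : α < 1 := by linarith
  set Mg := essSup (fun y => max (g y) 0) (bdryMeasure Ω) with hMg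
  set Mh := essSup (fun y => max (h y) 0) (volume.restrict (closure Ω)ᶜ) with hMh
  set F := essSup (fun y => distCompl Ω y ^ (2 - α) * max (f y) 0) (volume.restrict Ω) with hF
  have hMg0 : 0 ≤ Mg := essSup_nonneg_of_nonneg fun _ => le_max_right _ _
  have hMh0 : 0 ≤ Mh := essSup_nonneg_of_nonneg fun _ => le_max_right _ _
  have hF0 : 0 ≤ F := essSup_nonneg_of_nonneg fun y =>
    mul_nonneg (Real.rpow_nonneg (distCompl_nonneg Ω y) _) (le_max_right _ _)
  obtain ⟨c, -, hc⟩ := hw.exists_ae_norm_le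
  have hwm := hw.aestronglyMeasurable
  have hδ := distCompl_nonneg Ω
  -- The `ε` keeps `B` positive when `F = 0` and makes the final contradiction strict.
  have main : ∀ ε : ℝ, 0 < ε →
      ∀ y ∈ closure Ω, w y ≤ Mg + Mh + C' / α * (F + ε) * (K + profile κ α (distCompl Ω y)) := by
    intro ε hε
    set B := C' / α * (F + ε) with hB
    have hB0 : 0 < B := by positivity
    by_contra! hcon
    obtain ⟨y₁, hy₁, hwy₁⟩ := hcon
    have hψc : ContinuousOn (fun y => w y - (Mg + Mh + B * (K + profile κ α (distCompl Ω y))))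
        (closure Ω) :=
      hwcont.sub (continuous_const.add (continuous_const.mul (continuous_const.add
        ((continuous_profile hα).comp (continuous_distCompl Ω))))).continuousOn
    obtain ⟨x₀, hx₀c, hmax⟩ := hΩ_bdd.isCompact_closure.exists_isMaxOn ⟨y₁, hy₁⟩ hψc
    have hpos : Mg + Mh + B * (K + profile κ α (distCompl Ω x₀)) < w x₀ := by
      have h1 := isMaxOn_iff.1 hmax y₁ hy₁
      linarith
    have hprof : ∀ y, 0 ≤ profile κ α (distCompl Ω y) := fun y => profile_nonneg hκ0 (hδ y)
    have hx₀ : x₀ ∈ Ω := by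
      by_contra hx₀Ω
      have h1 : x₀ ∈ frontier Ω := by
        rw [hΩ_open.frontier_eq]
        exact ⟨hx₀c, hx₀Ω⟩
      have h2 := le_essSup_on_frontier hN hΩ_open hΩ_C2 hwcont hg hsub.boundary h1
      have h3 : 0 ≤ B * (K + profile κ α (distCompl Ω x₀)) :=
        mul_nonneg hB0.le (add_nonneg hK0.le (hprof x₀))
      linarith
    obtain ⟨p, q, hxp, hpq, hxq, hq⟩ := hext x₀ hx₀
    have hd : 0 < distCompl Ω x₀ := distCompl_pos hN hΩ_open hΩ_bdd hx₀
    have hdD : distCompl Ω x₀ ≤ D := hD x₀ hx₀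
    have hball := ball_distCompl_subset (Ω := Ω) x₀
    set d := distCompl Ω x₀ with hd_def
    have htouch : ∀ y ∈ closure Ω,
        w y - w x₀ ≤ B * (profile κ α (distCompl Ω y) - profile κ α d) := fun y hy => by
      have h1 := isMaxOn_iff.1 hmax y hy
      linarith
    have htouch' : ∀ y ∈ closure Ω,
        w y - w x₀ ≤ B * (profile κ α (‖y - q‖ - ρ) - profile κ α d) := fun y hy => by
      refine (htouch y hy).trans (mul_le_mul_of_nonneg_left (sub_le_sub_right ?_ _) hB0.le)
      exact profile_mono hκ0 hα (hδ y) (by linarith [hq y hy])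
    -- The jump: outside, `w ≤ Mh`, while `w x₀` exceeds `Mh + B K`.
    have hout : ∀ᵐ y, y ∉ closure Ω → B * K ≤ w x₀ - w y := by
      have h1 : ∀ᵐ y ∂(volume.restrict (closure Ω)ᶜ), w y ≤ Mh := by
        filter_upwards [hsub.exterior, ae_max_zero_le_essSup hh] with y h1 h2
        exact h1.trans h2
      rw [ae_restrict_iff' isClosed_closure.measurableSet.compl] at h1
      filter_upwards [h1] with y hy hyc
      have h2 := hy hyc
      have h3 := mul_nonneg hB0.le (hprof x₀)
      linarith
    have hwx₀ : ContDiffAt ℝ 2 w x₀ := hwC2.contDiffAt (hΩ_open.mem_nhds hx₀)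
    have hlap : Laplacian.laplacian w x₀ ≤
        B * (profileDeriv2 κ α d + κ * profileDeriv κ α d) := by
      refine laplacian_le_of_touching_profile hN hwx₀ hα hα1 hρ hκ hd hB0.le hxq ?_
      filter_upwards [hΩ_open.mem_nhds hx₀] with y hy
      exact htouch' y (subset_closure hy)
    have hfrac : 0 < fracLaplacian σ w x₀ := by
      obtain ⟨e, he⟩ := exists_ball_in_exterior hd hdD hρ hρ1 hD1 hxp hpq hxq
      refine fracLaplacian_pos hN hσ₀ hσ₁ hwm hc hwx₀ hd hθ0 hA2 hB0 hK0.le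
        (fun z hz => (he z hz).1) (fun z hz => ?_) ?_ ?_ hKV
      · refine secondDiff_ge_of_touching_profile hα hα1 hρ hκ0 hd hdD hB0.le hxq
          (fun y hy => ?_) hz
        have hyc := subset_closure (hball hy)
        exact ⟨by linarith [hq y hyc, hδ y], htouch' y hyc⟩
      · filter_upwards [ae_comp_add hout x₀] with z hz _
        by_cases hzc : x₀ + z ∈ closure Ω
        · have h1 := htouch _ hzc
          have h2 := profile_le_one hκ0 hα (hδ (x₀ + z))
          have h3 := mul_le_mul_of_nonneg_left
            (show profile κ α (distCompl Ω (x₀ + z)) - profile κ α d ≤ 1 by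
              linarith [hprof x₀]) hB0.le
          linarith
        · have h1 := hz hzc
          have h2 := mul_pos hB0 hK0
          linarith
      · filter_upwards [ae_comp_add hout x₀] with z hz hze
        refine hz fun hzc => ?_
        linarith [hq _ hzc, hδ (x₀ + z), (he z hze).2]
    have hcontr : -(Laplacian.laplacian w x₀) - F * d ^ (α - 2) ≤ 0 := by
      refine nonpos_of_ae_imp (μ := volume) (a := fracLaplacian σ w)
        (b := fun y => -(Laplacian.laplacian w y) - F * distCompl Ω y ^ (α - 2))
        hΩ_open hΩ_open.measurableSet hx₀
        (continuousAt_fracLaplacian hN hσ₀ hσ₁ hwm hc hwx₀) ?_ ?_ hfrac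
      · exact (continuousAt_laplacian hwx₀).neg.sub (continuousAt_const.mul
          ((continuous_distCompl Ω).continuousAt.rpow_const (Or.inl hd.ne')))
      · filter_upwards [hsub.interior, hΦ, ae_le_rpow_of_interior hN hΩ_open hΩ_bdd hf]
          with y h1 h2 h3 h4
        have h5 := h2.1 h4
        linarith [h2.2]
    have hG := profileDeriv2_add_le hκ1 hα hα1 hd hdD
    have hBG := mul_le_mul_of_nonneg_left hG hB0.le
    have hdα : 0 < d ^ (α - 2) := Real.rpow_pos_of_pos hd _
    have hcoef : F + ε ≤ B * (α * (1 - α) * Real.exp (-(2 * κ * D))) := by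
      have h1 : B * (α * (1 - α) * Real.exp (-(2 * κ * D))) =
          (F + ε) * ((1 - α) / (1 - αbar)) := by
        rw [hB, hC', Real.exp_neg]
        field_simp
      rw [h1]
      refine le_mul_of_one_le_right (by positivity) ?_
      rw [one_le_div hαbar']
      linarith
    have hfin := mul_le_mul_of_nonneg_right hcoef hdα.le
    have := mul_pos hε hdα
    linarith
  have hlim : ∀ ε : ℝ, 0 < ε → w x ≤ Mg + Mh + C' * (K + 1) * α⁻¹ * (F + ε) := fun ε hε => by
    refine (main ε hε x (subset_closure hx)).trans ?_
    have h1 := profile_le_one hκ0 hα (hδ x)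
    have h2 : C' / α * (F + ε) * (K + profile κ α (distCompl Ω x)) ≤
        C' / α * (F + ε) * (K + 1) := by gcongr
    have h3 : C' / α * (F + ε) * (K + 1) = C' * (K + 1) * α⁻¹ * (F + ε) := by
      field_simp
    linarith
  have ht : Tendsto (fun ε : ℝ => Mg + Mh + C' * (K + 1) * α⁻¹ * (F + ε)) (𝓝[>] 0)
      (𝓝 (Mg + Mh + C' * (K + 1) * α⁻¹ * (F + 0))) :=
    (Continuous.tendsto (by fun_prop) 0).mono_left nhdsWithin_le_nhds
  rw [add_zero] at ht
  exact ge_of_tendsto ht (by filter_upwards [self_mem_nhdsWithin] with ε hε using hlim ε hε)
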